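/- Let $\mathrm{ZFU_R}$ be the first-order theory in the language $\{\in,\mathcal A\}$ with equality, where the unary predicate $\mathcal A(x)$ says that $x$ is an urelement (and a \emph{set} is an object that is not an urelement), whose axioms are: urelements have no members, Extensionality for sets, Foundation, Pairing, Union, Powerset, Infinity, and the schemata of Separation and Replacement. (The urelements may form a proper class; the Axiom of Choice and the Collection schema are not among the axioms.) The \emph{Collection Principle} is the schema which says, for every formula $\varphi(x,y,\bar u)$: for all $w$ and $\bar u$, if $\forall x\in w\,\exists y\,\varphi(x,y,\bar u)$, then there is a set $v$ such that $\forall x\in w\,\exists y\in v\,\varphi(x,y,\bar u)$. The \emph{Reflection Principle} is the schema which says, for every formula $\varphi(x_1,\dots,x_n)$: for every set $x$ there is a transitive set $t\supseteq x$ such that for all $x_1,\dots,x_n\in t$, $\varphi(x_1,\dots,x_n)\leftrightarrow\varphi^t(x_1,\dots,x_n)$, where $\varphi^t$ is obtained from $\varphi$ by restricting all quantifiers to members of $t$. Then in every model of $\mathrm{ZFU_R}$ (equivalently, provably in $\mathrm{ZFU_R}$): 1. If every set of urelements is well-orderable, then the Collection Principle (all instances) holds if and only if the Reflection Principle (all instances)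 holds. 2. If the urelements form a set, i.e. there is a set whose members are exactly the urelements, then the Reflection Principle holds. -/

import Mathlib

open FirstOrder

universe u

namespace UrelementSetTheory

/-- The non-logical symbols: a binary symbol for membership and a unary symbol for
"is an urelement". -/
inductive Rel : ℕ → Type
  | mem : Rel 2
  | ur : Rel 1

/-- The first-order language (with equality) of urelement set theory. -/
def lang : Language where
  Functions := fun _ => Empty
  Relations := Rel

section Basic

variable {M : Type u} [lang.Structure M]

/-- `x ∈ y` in the structure `M`. -/
def Mem (x y : M) : Prop :=
  Language.Structure.RelMap (L := lang) Rel.mem ![x, y]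

/-- `x` is an urelement of the structure `M`. -/
def Ur (x : M) : Prop :=
  Language.Structure.RelMap (L := lang) Rel.ur ![x]

/-- Sets are the objects that are not urelements. -/
def IsSet (x : M) : Prop := ¬ Ur x

/-- Every member of `x` is a member of `y`. -/
def Sub (x y : M) : Prop := ∀ z : M, Mem z x → Mem z y

/-- `t` is a transitive set. -/
def IsTransitiveSet (t : M) : Prop :=
  IsSet t ∧ ∀ y : M, Mem y t → Sub y t

/-- `z = {x, y}`. -/
def IsPairSet (z x y : M) : Prop :=
  IsSet z ∧ ∀ v : M, Mem v z ↔ v = x ∨ v = y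

/-- `p` is the Kuratowski pair `⟨x, y⟩ = {{x}, {x, y}}`. -/
def IsOrdPair (p x y : M) : Prop :=
  ∃ a b : M, IsPairSet a x x ∧ IsPairSet b x y ∧ IsPairSet p a b

/-- `⟨x, y⟩ ∈ r`. -/
def Related (r x y : M) : Prop := ∃ p : M, IsOrdPair p x y ∧ Mem p r

/-- The set `r` of the structure, viewed as a binary relation, is a strict well-ordering of `x`
in the sense of the structure. -/
def WellOrders (r x : M) : Prop :=
  (∀ a : M, Mem a x → ¬ Related r a a) ∧
  (∀ a b c : M, Mem a x → Mem b x → Mem c x →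
    Related r a b → Related r b c → Related r a c) ∧
  (∀ a b : M, Mem a x → Mem b x → Related r a b ∨ a = b ∨ Related r b a) ∧
  (∀ s : M, IsSet s → Sub s x → (∃ a : M, Mem a s) →
    ∃ a : M, Mem a s ∧ ∀ b : M, Mem b s → b ≠ a → Related r a b)

/-- `x` is well-orderable in the structure. -/
def WellOrderable (x : M) : Prop := ∃ r : M, IsSet r ∧ WellOrders r x

/-- `x` is a set of urelements. -/
def IsSetOfUr (x : M) : Prop := IsSet x ∧ ∀ y : M, Mem y x → Ur y

/-- `RealizeIn t φ v xs` is the truth in `M` of the relativization `φ^t`: the quantifiers of `φ`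
are bounded to the members of `t`, and everything else is left unchanged. -/
def RealizeIn {α : Type} (t : M) :
    {n : ℕ} → lang.BoundedFormula α n → (α → M) → (Fin n → M) → Prop
  | _, .falsum, _, _ => False
  | _, .equal t₁ t₂, v, xs =>
      t₁.realize (Sum.elim v xs) = t₂.realize (Sum.elim v xs)
  | _, .rel R ts, v, xs =>
      Language.Structure.RelMap R fun i => (ts i).realize (Sum.elim v xs)
  | _, .imp φ ψ, v, xs => RealizeIn t φ v xs → RealizeIn t ψ v xs
  | _, .all φ, v, xs => ∀ a : M, Mem a t → RealizeIn t φ v (Fin.snoc xs a)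

end Basic

/-- `M` is a model of `ZFU_R`: ZF with Replacement (not Collection), modified to allow a class of
urelements, possibly a proper one. -/
structure ModelsZFUR (M : Type u) [lang.Structure M] : Prop where
  ur_no_members : ∀ x : M, Ur x → ∀ y : M, ¬ Mem y x
  extensionality : ∀ x y : M, IsSet x → IsSet y → (∀ z : M, Mem z x ↔ Mem z y) → x = y
  foundation : ∀ x : M, (∃ y : M, Mem y x) → ∃ y : M, Mem y x ∧ ∀ z : M, Mem z y → ¬ Mem z x
  pairing : ∀ x y : M, ∃ z : M, IsPairSet z x y
  union : ∀ x : M, ∃ y : M, IsSet y ∧ ∀ z : M, Mem z y ↔ ∃ w : M, Mem w x ∧ Mem z w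
  powerset : ∀ x : M, ∃ y : M, IsSet y ∧ ∀ z : M, Mem z y ↔ IsSet z ∧ Sub z x
  infinity : ∃ s : M, IsSet s ∧ (∃ e : M, Mem e s ∧ IsSet e ∧ ∀ z : M, ¬ Mem z e) ∧
    ∀ x : M, Mem x s → ∃ y : M, Mem y s ∧ IsSet y ∧ ∀ z : M, Mem z y ↔ Mem z x ∨ z = x
  separation : ∀ (n : ℕ) (φ : lang.Formula (Fin (n + 1))) (p : Fin n → M) (w : M),
    ∃ s : M, IsSet s ∧ ∀ x : M, Mem x s ↔ Mem x w ∧ φ.Realize (Matrix.vecCons x p)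
  replacement : ∀ (n : ℕ) (φ : lang.Formula (Fin (n + 2))) (p : Fin n → M) (w : M),
    (∀ x : M, Mem x w → ∃! y : M, φ.Realize (Matrix.vecCons x (Matrix.vecCons y p))) →
    ∃ v : M, IsSet v ∧ ∀ x : M, Mem x w →
      ∃ y : M, Mem y v ∧ φ.Realize (Matrix.vecCons x (Matrix.vecCons y p))

/-- `M` satisfies every instance of the Collection Principle. -/
def CollectionPrinciple (M : Type u) [lang.Structure M] : Prop :=
  ∀ (n : ℕ) (φ : lang.Formula (Fin (n + 2))) (p : Fin n → M) (w : M),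
    (∀ x : M, Mem x w → ∃ y : M, φ.Realize (Matrix.vecCons x (Matrix.vecCons y p))) →
    ∃ v : M, IsSet v ∧ ∀ x : M, Mem x w →
      ∃ y : M, Mem y v ∧ φ.Realize (Matrix.vecCons x (Matrix.vecCons y p))

/-- `M` satisfies every instance of the Reflection Principle: for every formula `φ`, every set is
included in a transitive set `t` over which `φ` and `φ^t` agree. -/
def ReflectionPrinciple (M : Type u) [lang.Structure M] : Prop :=
  ∀ (n : ℕ) (φ : lang.Formula (Fin n)) (x : M), IsSet x →
    ∃ t : M, IsTransitiveSet t ∧ Sub x t ∧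
      ∀ v : Fin n → M, (∀ i, Mem (v i) t) → (φ.Realize v ↔ RealizeIn t φ v default)

/-- In `M`, every set of urelements is well-orderable. -/
def UrSetsWellOrderable (M : Type u) [lang.Structure M] : Prop :=
  ∀ x : M, IsSetOfUr x → WellOrderable x

/-- In `M`, the urelements form a set. -/
def UrelementsFormSet (M : Type u) [lang.Structure M] : Prop :=
  ∃ s : M, IsSet s ∧ ∀ x : M, Mem x s ↔ Ur x

end UrelementSetTheory

/-! Let V(A, α) be the cumulative hierarchy over a set A of urelements. Every x lies in some V(ker
x, α), where ker x is the set of urelements in the transitive closure of {x} (`exists_mem_V_ker`).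
If the urelements form a set A, the levels V(A, α) exhaust the universe and Lévy's argument applies:
Replacement, applied to least ranks of witnesses, bounds the levels where witnesses appear, and the
union of the levels below an ordinal closed under these bounds reflects φ.

Reflection gives Collection by reflecting one formula that codes both φ and ∃y φ
(`collection_of_reflection`).

For the converse no V(A, ·) need exhaust the universe, and automorphisms make up for this. Enlarge
ker x to a set A of urelements that is stable: no further enlargement changes which ordinals inject
into the remaining urelements (`exists_avail_stable`). Then for B ⊇ A, any two injections of an
ordinal into the urelements outside B are conjugate by a definable automorphism fixing B pointwise
(`exists_aut_conj`). The part of a witness's kernel outside B is well-orderable, hence enumerated by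
such an injection, so witnesses can be moved to prescribed urelements.

If every ordinal injects into the urelements outside A, the levels are V(A ∪ f[α], α) for injections
f; by homogeneity the bounds on witnesses do not depend on f, so a single f, chosen after the closed
ordinal is known, suffices (`isHierarchy_of_plenty`). Otherwise let θ be the least ordinal that does
not inject. Collection yields one set of urelements outside A into which all ordinals below θ
inject, and from it an increasing ω-chain X_n such that they all inject into each X_{n+1} \ X_n. A
witness for parameters over A ∪ X_n can be moved over A ∪ X_{n+1}, so the union of all V(A ∪ X_n, α)
is an elementary submodel and Lévy's argument applies to it (`exists_hierarchy_of_scarcity`). Both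
cases, and the case of a set of urelements, end in `IsHierarchy.exists_reflecting`. -/

namespace UrelementSetTheory

set_option synthInstance.maxSize 2000
set_option synthInstance.maxHeartbeats 200000

/-! ### Definability with parameters, by instance search -/

section Definability

/-- A type of environments for formulas over `M`: `adm` holds the functions that read off a
coordinate, and the constants. -/
class Ctx (M : Type u) (E : Type u) where
  adm : Set (E → M)
  const_mem : ∀ c : M, (fun _ => c) ∈ adm

variable {M : Type u} {E F G : Type u}

instance Ctx.base : Ctx M M where
  adm := {f | f = id ∨ ∃ c, f = fun _ => c}
  const_mem c := Or.inr ⟨c, rfl⟩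

instance Ctx.pi {ι : Type} : Ctx M (ι → M) where
  adm := {f | (∃ i, f = fun v => v i) ∨ ∃ c, f = fun _ => c}
  const_mem c := Or.inr ⟨c, rfl⟩

instance Ctx.prod [Ctx M E] [Ctx M F] : Ctx M (E × F) where
  adm := {f | (∃ g ∈ Ctx.adm (M := M) (E := E), f = fun p => g p.1) ∨
    ∃ g ∈ Ctx.adm (M := M) (E := F), f = fun p => g p.2}
  const_mem c := Or.inl ⟨_, Ctx.const_mem c, rfl⟩

variable (M) in
/-- A map of environments all of whose coordinates are coordinates or constants. -/
class IsProj [Ctx M E] [Ctx M F] (h : E → F) : Prop where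
  comp_mem : ∀ t ∈ Ctx.adm (M := M) (E := F), (fun e => t (h e)) ∈ Ctx.adm (M := M) (E := E)

instance IsProj.id [Ctx M E] : IsProj M (fun e : E => e) := ⟨fun _ h => h⟩

instance IsProj.fst [Ctx M E] [Ctx M F] [Ctx M G] (g : E → F × G) [hg : IsProj M g] :
    IsProj M (fun e => (g e).1) :=
  ⟨fun t ht => hg.comp_mem (fun p => t p.1) (Or.inl ⟨t, ht, rfl⟩)⟩

instance IsProj.snd [Ctx M E] [Ctx M F] [Ctx M G] (g : E → F × G) [hg : IsProj M g] :
    IsProj M (fun e => (g e).2) :=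
  ⟨fun t ht => hg.comp_mem (fun p => t p.2) (Or.inr ⟨t, ht, rfl⟩)⟩

theorem IsProj.pair [Ctx M E] [Ctx M F] [Ctx M G] (f : E → F) (g : E → G) [hf : IsProj M f]
    [hg : IsProj M g] : IsProj M (fun e => (f e, g e)) := by
  refine ⟨?_⟩
  rintro t (⟨s, hs, rfl⟩ | ⟨s, hs, rfl⟩)
  · exact hf.comp_mem s hs
  · exact hg.comp_mem s hs

instance IsProj.const [Ctx M E] (c : M) : IsProj M (fun _ : E => c) := by
  refine ⟨?_⟩
  rintro t _
  exact Ctx.const_mem _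

theorem IsProj.comp [Ctx M E] [Ctx M F] [Ctx M G] (f : F → G) (g : E → F) [hf : IsProj M f]
    [hg : IsProj M g] : IsProj M (fun e => f (g e)) :=
  ⟨fun t ht => hg.comp_mem _ (hf.comp_mem t ht)⟩

variable [lang.Structure M]

variable (M) in
/-- `P` is definable with parameters in `M`. -/
class Def [Ctx M E] (P : E → Prop) : Prop where
  out : ∃ (κ : Type) (_ : Finite κ) (φ : lang.Formula κ) (t : κ → E → M),
    (∀ i, t i ∈ Ctx.adm (M := M) (E := E)) ∧ ∀ e, P e ↔ φ.Realize (fun i => t i e)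

/-- `f` has a graph that is definable with parameters. -/
class DF [Ctx M E] (f : E → M) : Prop where
  out : Def M (fun p : E × M => p.2 = f p.1)

theorem Def.of_iff [Ctx M E] {P Q : E → Prop} (h : Def M Q) (hPQ : ∀ e, P e ↔ Q e) : Def M P := by
  have : P = Q := funext fun e => propext (hPQ e)
  rwa [this]

theorem Def.comp [Ctx M E] [Ctx M F] {P : F → Prop} (hP : Def M P) (h : E → F) [hh : IsProj M h] :
    Def M (fun e => P (h e)) := by
  obtain ⟨κ, hκ, φ, t, ht, hφ⟩ := hP.out
  exact ⟨κ, hκ, φ, fun i e => t i (h e), fun i => hh.comp_mem _ (ht i), fun e => hφ _⟩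

/-- Truth of a fixed formula is definable. -/
theorem Def.realize {ι : Type} [Finite ι] (φ : lang.Formula ι) :
    Def M (fun v : ι → M => φ.Realize v) :=
  ⟨ι, inferInstance, φ, fun i v => v i, fun i => Or.inl ⟨i, rfl⟩, fun _ => Iff.rfl⟩

instance Def.imp [Ctx M E] (P Q : E → Prop) [hP : Def M P] [hQ : Def M Q] :
    Def M (fun e => P e → Q e) := by
  obtain ⟨κ, hκ, φ, t, ht, hφ⟩ := hP.out
  obtain ⟨κ', hκ', φ', t', ht', hφ'⟩ := hQ.out
  refine ⟨κ ⊕ κ', inferInstance, (φ.relabel Sum.inl).imp (φ'.relabel Sum.inr),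
    Sum.elim t t', by rintro (i | i) <;> simp [ht, ht'], fun e => ?_⟩
  rw [Language.Formula.realize_imp, Language.Formula.realize_relabel,
    Language.Formula.realize_relabel, hφ, hφ']
  rfl

instance Def.false [Ctx M E] : Def M (fun _ : E => False) :=
  ⟨Empty, inferInstance, ⊥, fun i => i.elim, fun i => i.elim, fun e => by
    simp⟩

instance Def.not [Ctx M E] (P : E → Prop) [hP : Def M P] : Def M (fun e => ¬ P e) :=
  Def.imp P (fun _ => False)

instance Def.true [Ctx M E] : Def M (fun _ : E => True) :=
  (Def.not (M := M) (fun _ : E => False)).of_iff (by simp)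

instance Def.const [Ctx M E] (p : Prop) : Def M (fun _ : E => p) := by
  by_cases h : p <;> simp only [h] <;> infer_instance

instance Def.and [Ctx M E] (P Q : E → Prop) [Def M P] [Def M Q] :
    Def M (fun e => P e ∧ Q e) :=
  (inferInstance : Def M (fun e => ¬ (P e → ¬ Q e))).of_iff (by simp)

instance Def.or [Ctx M E] (P Q : E → Prop) [Def M P] [Def M Q] :
    Def M (fun e => P e ∨ Q e) :=
  (inferInstance : Def M (fun e => ¬ P e → Q e)).of_iff (fun _ => or_iff_not_imp_left)

instance Def.iff [Ctx M E] (P Q : E → Prop) [Def M P] [Def M Q] :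
    Def M (fun e => P e ↔ Q e) :=
  (inferInstance : Def M (fun e => (P e → Q e) ∧ (Q e → P e))).of_iff
    (fun _ => iff_iff_implies_and_implies)

/-- Since g parametrizes F by finite tuples of elements, each argument slot of the formula either
depends only on E and stays free, or reads a coordinate of the tuple and gets bound. Quantifiers
over elements and over tuples are both instances. -/
theorem Def.all_of_ctx [Nonempty M] [Ctx M E] [Ctx M F] {ι : Type} [Finite ι] (g : (ι → M) → F)
    (hg : Function.Surjective g) (hF : ∀ f ∈ Ctx.adm (M := M) (E := F),
      (∃ i : ι, ∀ v, f (g v) = v i) ∨ ∃ c, f = fun _ => c)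
    (Q : E → F → Prop) (hQ : Def M (fun p : E × F => Q p.1 p.2)) :
    Def M (fun e => ∀ x : F, Q e x) := by
  classical
  obtain ⟨κ, hκ, φ, t, ht, hφ⟩ := hQ.out
  have key : ∀ i, (∃ f ∈ Ctx.adm (M := M) (E := E), t i = fun p => f p.1) ∨
      ∃ j : ι, ∀ p v, t i (p, g v) = v j := by
    intro i
    rcases ht i with ⟨f, hf, h⟩ | ⟨f, hf, h⟩
    · exact Or.inl ⟨f, hf, h⟩
    · rcases hF f hf with ⟨j, hj⟩ | ⟨c, rfl⟩
      · exact Or.inr ⟨j, fun p v => by rw [h]; exact hj v⟩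
      · exact Or.inl ⟨fun _ => c, Ctx.const_mem c, h⟩
  let c := Classical.arbitrary M
  -- `s` gives the values of the free slots, with an irrelevant default on the bound ones; `l` sends
  -- each slot to its free or bound variable.
  let s : κ → E → M := fun i => if h : ∃ f ∈ Ctx.adm (M := M) (E := E), t i = fun p => f p.1
    then h.choose else fun _ => c
  let l : κ → κ ⊕ ι := fun i => if h : ∃ f ∈ Ctx.adm (M := M) (E := E), t i = fun p => f p.1
    then Sum.inl i else Sum.inr ((key i).resolve_left h).choose
  refine ⟨κ, hκ, (φ.relabel l).iAlls ι, s, fun i => ?_, fun e => ?_⟩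
  · by_cases h : ∃ f ∈ Ctx.adm (M := M) (E := E), t i = fun p => f p.1
    · simp only [s, dif_pos h]; exact h.choose_spec.1
    · simp only [s, dif_neg h]; exact Ctx.const_mem c
  · rw [Language.Formula.realize_iAlls]
    refine (hg.forall).trans (forall_congr' fun v => ?_)
    refine (hφ (e, g v)).trans ?_
    rw [Language.Formula.realize_relabel]
    refine iff_of_eq (congrArg _ (funext fun i => ?_))
    by_cases h : ∃ f ∈ Ctx.adm (M := M) (E := E), t i = fun p => f p.1
    · simp only [Function.comp, s, l, dif_pos h, Sum.elim_inl]
      exact congrFun h.choose_spec.2 _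
    · simp only [Function.comp, l, dif_neg h, Sum.elim_inr]
      exact ((key i).resolve_left h).choose_spec e v

instance Def.all [Nonempty M] [Ctx M E] (Q : E → M → Prop)
    [hQ : Def M (fun p : E × M => Q p.1 p.2)] : Def M (fun e => ∀ x : M, Q e x) := by
  refine Def.all_of_ctx (ι := Fin 1) (fun v => v 0) (fun x => ⟨fun _ => x, rfl⟩) ?_ Q hQ
  rintro f (rfl | ⟨c, rfl⟩)
  · exact Or.inl ⟨0, fun _ => rfl⟩
  · exact Or.inr ⟨c, rfl⟩

instance Def.all_pi [Nonempty M] [Ctx M E] {ι : Type} [Finite ι] (Q : E → (ι → M) → Prop)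
    [hQ : Def M (fun p : E × (ι → M) => Q p.1 p.2)] : Def M (fun e => ∀ x : ι → M, Q e x) := by
  refine Def.all_of_ctx (ι := ι) id Function.surjective_id ?_ Q hQ
  rintro f (⟨i, rfl⟩ | ⟨c, rfl⟩)
  · exact Or.inl ⟨i, fun _ => rfl⟩
  · exact Or.inr ⟨c, rfl⟩

instance Def.ex [Nonempty M] [Ctx M E] (Q : E → M → Prop)
    [hQ : Def M (fun p : E × M => Q p.1 p.2)] : Def M (fun e => ∃ x : M, Q e x) :=
  (inferInstance : Def M (fun e => ¬ ∀ x : M, ¬ Q e x)).of_iff (by simp)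

instance Def.all_fin [Ctx M E] {ι : Type} [Finite ι] (Q : E → ι → Prop)
    [hQ : ∀ i, Def M (fun e => Q e i)] : Def M (fun e => ∀ i : ι, Q e i) := by
  choose κ hκ φ t ht hφ using fun i => (hQ i).out
  refine ⟨Σ i, κ i, inferInstance, Language.Formula.iInf
    (fun i => (φ i).relabel (fun k => (⟨i, k⟩ : Σ i, κ i))), fun p => t p.1 p.2,
    fun p => ht _ _, fun e => ?_⟩
  rw [Language.Formula.realize_iInf]
  refine forall_congr' fun i => ?_
  rw [hφ, Language.Formula.realize_relabel]
  rfl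

theorem Def.adm_eq [Ctx M E] {f g : E → M} (hf : f ∈ Ctx.adm (M := M) (E := E))
    (hg : g ∈ Ctx.adm (M := M) (E := E)) : Def M (fun e => f e = g e) :=
  ⟨Fin 2, inferInstance, Language.Term.equal (Language.Term.var 0) (Language.Term.var 1), ![f, g],
    by intro i; fin_cases i <;> assumption, fun e => by
      simp [Language.Formula.realize_equal]⟩

theorem Def.adm_mem [Ctx M E] {f g : E → M} (hf : f ∈ Ctx.adm (M := M) (E := E))
    (hg : g ∈ Ctx.adm (M := M) (E := E)) : Def M (fun e => Mem (f e) (g e)) :=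
  ⟨Fin 2, inferInstance, Language.Relations.formula₂ (L := lang) Rel.mem
    (Language.Term.var 0) (Language.Term.var 1), ![f, g],
    by intro i; fin_cases i <;> assumption, fun e =>
    (Language.Formula.realize_rel₂ (L := lang) (R := Rel.mem) (t₁ := Language.Term.var 0)
      (t₂ := Language.Term.var 1) (v := fun i : Fin 2 => ![f, g] i e)).symm⟩

theorem Def.adm_ur [Ctx M E] {f : E → M} (hf : f ∈ Ctx.adm (M := M) (E := E)) :
    Def M (fun e => Ur (f e)) :=
  ⟨Fin 1, inferInstance, Language.Relations.formula₁ (L := lang) Rel.ur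
    (Language.Term.var 0), ![f],
    by intro i; fin_cases i; assumption, fun e =>
    (Language.Formula.realize_rel₁ (L := lang) (R := Rel.ur) (t := Language.Term.var 0)
      (v := fun i : Fin 1 => ![f] i e)).symm⟩

theorem DF.of_adm [Ctx M E] {f : E → M} (hf : f ∈ Ctx.adm (M := M) (E := E)) : DF f :=
  ⟨Def.adm_eq (Or.inr ⟨_, Or.inl rfl, rfl⟩) (Or.inl ⟨_, hf, rfl⟩)⟩

instance DF.const [Ctx M E] (c : M) : DF (fun _ : E => c) := DF.of_adm (Ctx.const_mem c)

instance DF.id : DF (fun x : M => x) := DF.of_adm (Or.inl rfl)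

theorem DF.proj [Ctx M E] (g : E → M) [hg : IsProj M g] : DF g :=
  DF.of_adm (hg.comp_mem (fun x => x) (Or.inl rfl))

instance DF.fst [Ctx M E] [Ctx M F] (g : E → M × F) [hg : IsProj M g] : DF (fun e => (g e).1) :=
  DF.proj _

instance DF.snd [Ctx M E] [Ctx M F] (g : E → F × M) [hg : IsProj M g] : DF (fun e => (g e).2) :=
  DF.proj _

instance DF.coord [Ctx M E] {ι : Type} (g : E → (ι → M)) [hg : IsProj M g] (i : ι) :
    DF (fun e => g e i) :=
  DF.of_adm (hg.comp_mem (fun v => v i) (Or.inl ⟨i, rfl⟩))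

theorem DF.comp [Ctx M E] [Ctx M F] {f : F → M} (hf : DF f) (h : E → F) [IsProj M h] :
    DF (fun e => f (h e)) :=
  have := IsProj.comp (M := M) h (fun p : E × M => p.1)
  have := IsProj.pair (M := M) (fun p : E × M => h p.1) (fun p : E × M => p.2)
  ⟨hf.out.comp (fun p : E × M => (h p.1, p.2))⟩

theorem Def.comp_pair [Ctx M E] [Ctx M F] {P : F → M → Prop}
    (hP : Def M (fun p : F × M => P p.1 p.2)) (a : E → F) (b : E → M) [IsProj M a] [IsProj M b] :
    Def M (fun e => P (a e) (b e)) :=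
  have := IsProj.pair (M := M) a b
  hP.comp (fun e => (a e, b e))

theorem DF.comp_pair [Ctx M E] [Ctx M F] {f : F → M → M}
    (hf : DF (fun p : F × M => f p.1 p.2)) (a : E → F) (b : E → M) [IsProj M a] [IsProj M b] :
    DF (fun e => f (a e) (b e)) :=
  have := IsProj.pair (M := M) a b
  hf.comp (fun e => (a e, b e))

/-- Substitution of a definable function for the last variable. -/
theorem Def.subst [Nonempty M] [Ctx M E] {P : E → M → Prop}
    (hP : Def M (fun p : E × M => P p.1 p.2)) {f : E → M} (hf : DF f) :
    Def M (fun e => P e (f e)) := by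
  have := hf.out
  refine (inferInstance : Def M (fun e => ∃ x, x = f e ∧ P e x)).of_iff (by simp)

theorem DF.subst [Nonempty M] [Ctx M E] {g : E → M → M}
    (hg : DF (fun p : E × M => g p.1 p.2)) {f : E → M} (hf : DF f) :
    DF (fun e => g e (f e)) := by
  refine ⟨?_⟩
  have h1 : DF (fun p : E × M => f p.1) := hf.comp (fun p : E × M => p.1)
  have h3 := IsProj.pair (M := M) (fun p : (E × M) × M => p.1.1) (fun p : (E × M) × M => p.2)
  have h2 : Def M (fun p : (E × M) × M => p.1.2 = g p.1.1 p.2) :=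
    Def.comp_pair (F := E × M) (P := fun p x => x = g p.1 p.2) hg.out
      (fun p : (E × M) × M => (p.1.1, p.2)) (fun p => p.1.2)
  exact Def.subst (E := E × M) (P := fun p x => p.2 = g p.1 x) h2 h1

/-- Substitution of definable functions for the last variables. -/
theorem Def.subst₂ [Nonempty M] [Ctx M E] [Ctx M F] {P : F → M → Prop}
    (hP : Def M (fun p : F × M => P p.1 p.2)) (a : E → F) (b : E → M) [IsProj M a] [hb : DF b] :
    Def M (fun e => P (a e) (b e)) := by
  have := IsProj.comp (M := M) a (fun p : E × M => p.1)
  exact Def.subst (P := fun e x => P (a e) x)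
    (hP.comp_pair (fun p : E × M => a p.1) (fun p => p.2)) hb

theorem DF.subst₃ [Nonempty M] [Ctx M E] [Ctx M F] {f : F → M → M → M}
    (hf : DF (fun p : (F × M) × M => f p.1.1 p.1.2 p.2)) (a : E → F) (b c : E → M) [IsProj M a]
    [hb : DF b] [hc : DF c] : DF (fun e => f (a e) (b e) (c e)) := by
  have h0 := IsProj.comp (M := M) a (fun p : E × M => p.1)
  have h1 := IsProj.comp (M := M) a (fun p : (E × M) × M => p.1.1)
  have h2 := IsProj.pair (M := M) (fun p : (E × M) × M => a p.1.1) (fun p => p.1.2)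
  have h3 : DF (fun p : (E × M) × M => f (a p.1.1) p.1.2 p.2) :=
    DF.comp_pair (F := F × M) (f := fun p => f p.1 p.2) hf
      (fun p : (E × M) × M => (a p.1.1, p.1.2)) (fun p => p.2)
  have h4 : DF (fun p : E × M => c p.1) := hc.comp (fun p : E × M => p.1)
  have h5 : DF (fun p : E × M => f (a p.1) p.2 (c p.1)) :=
    DF.subst (E := E × M) (g := fun p x => f (a p.1) p.2 x) h3 h4
  exact DF.subst (g := fun e x => f (a e) x (c e)) h5 hb

variable [Nonempty M] [Ctx M E]

theorem DF.fun_comp {g : M → M} (hg : DF g) {f : E → M} (hf : DF f) : DF (fun e => g (f e)) :=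
  DF.subst (g := fun _ x => g x) (hg.comp (fun p : E × M => p.2)) hf

instance Def.eq (f g : E → M) [hf : DF f] [hg : DF g] : Def M (fun e => f e = g e) := by
  have h1 : Def M (fun p : E × M => f p.1 = p.2) := hf.out.of_iff (fun _ => eq_comm)
  exact Def.subst (P := fun e x => f e = x) h1 hg

instance Def.ne (f g : E → M) [hf : DF f] [hg : DF g] : Def M (fun e => f e ≠ g e) :=
  inferInstanceAs (Def M (fun e => ¬ f e = g e))

instance Def.mem (f g : E → M) [hf : DF f] [hg : DF g] : Def M (fun e => Mem (f e) (g e)) := by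
  have h0 : Def M (fun p : (E × M) × M => Mem p.2 p.1.2) :=
    Def.adm_mem (Or.inr ⟨_, Or.inl rfl, rfl⟩) (Or.inl ⟨_, Or.inr ⟨_, Or.inl rfl, rfl⟩, rfl⟩)
  have h1 : Def M (fun p : E × M => Mem (f p.1) p.2) :=
    Def.subst (E := E × M) (P := fun p x => Mem x p.2) h0 (hf.comp (fun p : E × M => p.1))
  exact Def.subst (P := fun e x => Mem (f e) x) h1 hg

instance Def.eq_left (x : M) : Def M (Eq x) := Def.eq (fun _ => x) (fun y => y)

instance Def.mem_left (x : M) : Def M (Mem x) := Def.mem (fun _ => x) (fun y => y)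

instance Def.ur (f : E → M) [hf : DF f] : Def M (fun e => Ur (f e)) := by
  have h0 : Def M (fun p : E × M => Ur p.2) := Def.adm_ur (Or.inr ⟨_, Or.inl rfl, rfl⟩)
  exact Def.subst (P := fun e x => Ur x) h0 hf

instance Def.isSet (f : E → M) [DF f] : Def M (fun e => IsSet (f e)) :=
  inferInstanceAs (Def M (fun e => ¬ Ur (f e)))

end Definability

/-! ### From definable classes back to instances of the schemata -/

section Schemata

variable {M : Type u} [lang.Structure M] [Nonempty M]

/-- Slots that read the argument are identified with variable 0, and constant slots become
parameters; evaluating a constant slot at an arbitrary `a` recovers its value. -/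
theorem Def.exists_formula₁ {P : M → Prop} (hP : Def M P) :
    ∃ (n : ℕ) (φ : lang.Formula (Fin (n + 1))) (p : Fin n → M),
      ∀ x, P x ↔ φ.Realize (Matrix.vecCons x p) := by
  classical
  obtain ⟨κ, hκ, φ, t, ht, hφ⟩ := hP.out
  obtain ⟨n, ⟨e⟩⟩ := Finite.exists_equiv_fin κ
  let a := Classical.arbitrary M
  refine ⟨n, φ.relabel (fun i => if t i = id then 0 else (e i).succ),
    fun j => t (e.symm j) a, fun x => (hφ x).trans ?_⟩
  rw [Language.Formula.realize_relabel]
  refine iff_of_eq (congrArg _ (funext fun i => ?_))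
  by_cases h : t i = id
  · simp [h]
  · obtain ⟨c, hc⟩ := (ht i).resolve_left h
    simp only [Function.comp, if_neg h, Matrix.cons_val_succ, Equiv.symm_apply_apply]
    simp [hc]

theorem Def.exists_formula₂ {R : M → M → Prop} (hR : Def M (fun p : M × M => R p.1 p.2)) :
    ∃ (n : ℕ) (φ : lang.Formula (Fin (n + 2))) (p : Fin n → M),
      ∀ x y, R x y ↔ φ.Realize (Matrix.vecCons x (Matrix.vecCons y p)) := by
  classical
  obtain ⟨κ, hκ, φ, t, ht, hφ⟩ := hR.out
  obtain ⟨n, ⟨e⟩⟩ := Finite.exists_equiv_fin κ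
  let a := Classical.arbitrary M
  refine ⟨n, φ.relabel (fun i => if t i = Prod.fst then 0 else if t i = Prod.snd then 1 else
    (e i).succ.succ), fun j => t (e.symm j) (a, a), fun x y => (hφ (x, y)).trans ?_⟩
  rw [Language.Formula.realize_relabel]
  refine iff_of_eq (congrArg _ (funext fun i => ?_))
  by_cases h : t i = Prod.fst
  · simp [h]
  by_cases h' : t i = Prod.snd
  · simp only [Function.comp, if_neg h, if_pos h']
    simp [h']
  · have hc : ∃ c, t i = fun _ => c := by
      rcases ht i with ⟨f, (rfl | ⟨c, rfl⟩), hf⟩ | ⟨f, (rfl | ⟨c, rfl⟩), hf⟩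
      · exact absurd hf h
      · exact ⟨c, hf⟩
      · exact absurd hf h'
      · exact ⟨c, hf⟩
    obtain ⟨c, hc⟩ := hc
    simp only [Function.comp, if_neg h, if_neg h', Matrix.cons_val_succ, Equiv.symm_apply_apply]
    simp [hc]

theorem CollectionPrinciple.collect (h : CollectionPrinciple M) {R : M → M → Prop}
    (hR : Def M (fun p : M × M => R p.1 p.2)) (w : M) (hw : ∀ x, Mem x w → ∃ y, R x y) :
    ∃ v : M, IsSet v ∧ ∀ x, Mem x w → ∃ y, Mem y v ∧ R x y := by
  obtain ⟨n, φ, p, hφ⟩ := hR.exists_formula₂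
  simp only [hφ] at hw ⊢
  exact h n φ p w hw

end Schemata

/-! ### Definite descriptions and class comprehension -/

section The

variable {M : Type u} [lang.Structure M] [hM : Fact (ModelsZFUR M)]

instance nonempty_of_models : Nonempty M := ⟨hM.out.infinity.choose⟩

theorem exists_empty : ∃ e : M, IsSet e ∧ ∀ z, ¬ Mem z e := by
  obtain ⟨s, -, ⟨e, -, he⟩, -⟩ := hM.out.infinity
  exact ⟨e, he⟩

theorem isSet_of_mem {x y : M} (h : Mem x y) : IsSet y :=
  fun hy => hM.out.ur_no_members y hy x h

theorem Ur.not_mem {x y : M} (h : Ur x) : ¬ Mem y x := hM.out.ur_no_members x h y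

theorem set_ext {x y : M} (hx : IsSet x) (hy : IsSet y) (h : ∀ z, Mem z x ↔ Mem z y) : x = y :=
  hM.out.extensionality x y hx hy h

variable (M) in
/-- The empty set. -/
noncomputable def emp : M := exists_empty.choose

theorem isSet_emp : IsSet (emp M) := exists_empty.choose_spec.1

theorem not_mem_emp (z : M) : ¬ Mem z (emp M) := exists_empty.choose_spec.2 z

open Classical in
/-- The unique object satisfying `P`, if there is one. -/
noncomputable def the (P : M → Prop) : M := if h : ∃! x, P x then h.choose else emp M

theorem the_spec {P : M → Prop} (h : ∃! x, P x) : P (the P) := by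
  rw [the, dif_pos h]; exact h.choose_spec.1

theorem the_eq {P : M → Prop} {a : M} (ha : P a) (h : ∀ x, P x → x = a) : the P = a :=
  h _ (the_spec ⟨a, ha, h⟩)

/-- The default value is spelled out in first-order terms, so that descriptions are definable
functions before existence and uniqueness are known. -/
theorem eq_the_iff (P : M → Prop) (y : M) : y = the P ↔
    (P y ∧ ∀ z, P z → z = y) ∨ ((¬ ∃ x, P x ∧ ∀ z, P z → z = x) ∧ y = emp M) := by
  by_cases h : ∃! x, P x
  · have h' : ∃ x, P x ∧ ∀ z, P z → z = x := h
    simp only [h', not_true_eq_false, false_and, or_false]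
    constructor
    · rintro rfl; exact ⟨the_spec h, fun z hz => h.unique hz (the_spec h)⟩
    · rintro ⟨hy, h1⟩; exact (the_eq hy h1).symm
  · have h' : ¬ ∃ x, P x ∧ ∀ z, P z → z = x := h
    rw [the, dif_neg h]
    simp only [h', not_false_eq_true, true_and, iff_or_self]
    rintro h2; exact absurd ⟨y, h2⟩ h'

variable {E : Type u} [Ctx M E]

instance DF.the (P : E → M → Prop) [hP : Def M (fun p : E × M => P p.1 p.2)] :
    DF (fun e => the (P e)) := by
  refine ⟨?_⟩
  have h1 : Def M (fun p : (E × M) × M => P p.1.1 p.2) :=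
    hP.comp_pair (fun p : (E × M) × M => p.1.1) (fun p => p.2)
  have h2 : Def M (fun p : ((E × M) × M) × M => P p.1.1.1 p.2) :=
    hP.comp_pair (fun p : ((E × M) × M) × M => p.1.1.1) (fun p => p.2)
  have h3 : Def M (fun p : E × M => P p.1 p.2) := hP
  exact (inferInstance : Def M (fun p : E × M => (P p.1 p.2 ∧ ∀ z, P p.1 z → z = p.2) ∨
    ((¬ ∃ x, P p.1 x ∧ ∀ z, P p.1 z → z = x) ∧ p.2 = emp M))).of_iff
    (fun p => eq_the_iff _ _)

/-- The set of all `x` with `P x`, if the class of these is a set. -/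
noncomputable def mkSet (P : M → Prop) : M := the (fun s => IsSet s ∧ ∀ x, Mem x s ↔ P x)

/-- The class `P` is a set. -/
def Small (P : M → Prop) : Prop := ∃ s : M, IsSet s ∧ ∀ x, Mem x s ↔ P x

theorem Small.mk_spec {P : M → Prop} (h : Small P) : IsSet (mkSet P) ∧ ∀ x, Mem x (mkSet P) ↔ P x := by
  obtain ⟨s, hs, hs'⟩ := h
  exact the_spec (P := fun s => IsSet s ∧ ∀ x, Mem x s ↔ P x)
    ⟨s, ⟨hs, hs'⟩, fun t ht => set_ext ht.1 hs fun z => (ht.2 z).trans (hs' z).symm⟩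

theorem Small.mem_mk {P : M → Prop} (h : Small P) {x : M} : Mem x (mkSet P) ↔ P x := h.mk_spec.2 x

theorem isSet_mk (P : M → Prop) : IsSet (mkSet P) := by
  by_cases h : ∃! s, IsSet s ∧ ∀ x, Mem x s ↔ P x
  · exact (the_spec h).1
  · rw [mkSet, the, dif_neg h]; exact isSet_emp

instance DF.mkSet (P : E → M → Prop) [hP : Def M (fun p : E × M => P p.1 p.2)] :
    DF (fun e => mkSet (P e)) := by
  have h2 : Def M (fun p : (E × M) × M => P p.1.1 p.2) :=
    hP.comp_pair (fun p : (E × M) × M => p.1.1) (fun p => p.2)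
  unfold UrelementSetTheory.mkSet
  infer_instance

instance Def.sub (f g : E → M) [DF f] [DF g] : Def M (fun e => Sub (f e) (g e)) := by
  have h1 : DF (fun p : E × M => f p.1) := DF.comp ‹_› _
  have h2 : DF (fun p : E × M => g p.1) := DF.comp ‹_› _
  unfold Sub
  infer_instance

end The

/-! ### Inclusion and transitivity -/

section Structure

variable {M : Type u} [lang.Structure M]

theorem Sub.refl (x : M) : Sub x x := fun _ h => h

theorem Sub.trans {x y z : M} (h : Sub x y) (h' : Sub y z) : Sub x z := fun _ hw => h' _ (h _ hw)

theorem IsTransitiveSet.mem_trans {t x y : M} (ht : IsTransitiveSet t) (hx : Mem x y)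
    (hy : Mem y t) : Mem x t := ht.2 y hy x hx

end Structure

/-! ### Basic set operations -/

section SetOps

variable {M : Type u} [lang.Structure M] [hM : Fact (ModelsZFUR M)] {E : Type u} [Ctx M E]

/-- Pulling a definable function back along a map of environments. -/
instance DF.app {F : Type u} [Ctx M F] (f : F → M) (g : E → F) [hf : DF f] [IsProj M g] :
    DF (fun e => f (g e)) := hf.comp g

theorem Small.sep (w : M) (P : M → Prop) [hP : Def M P] : Small (fun x : M => Mem x w ∧ P x) := by
  obtain ⟨n, φ, p, hφ⟩ := hP.exists_formula₁
  obtain ⟨s, hs, h⟩ := hM.out.separation n φ p w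
  exact ⟨s, hs, fun x => (h x).trans (and_congr_right fun _ => (hφ x).symm)⟩

theorem Small.of_subset {P : M → Prop} [hP : Def M P] {w : M} (h : ∀ x, P x → Mem x w) :
    Small P := by
  obtain ⟨s, hs, h'⟩ := Small.sep w P
  exact ⟨s, hs, fun x => (h' x).trans ⟨fun h => h.2, fun hx => ⟨h x hx, hx⟩⟩⟩

/-- Replacement only provides a set containing a value for each argument; as values are unique, it
contains the image, which Separation cuts out. -/
theorem Small.image (f : M → M) [hf : DF f] (w : M) :
    Small (fun y : M => ∃ x, Mem x w ∧ y = f x) := by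
  have h1 : Def M (fun p : M × M => p.2 = f p.1) := hf.out
  obtain ⟨n, φ, p, hφ⟩ := Def.exists_formula₂ (R := fun x y => y = f x) h1
  obtain ⟨v, hv, h⟩ := hM.out.replacement n φ p w
    (fun x _ => ⟨f x, (hφ _ _).1 rfl, fun y hy => (hφ _ _).2 hy⟩)
  refine Small.of_subset (w := v) ?_
  rintro y ⟨x, hx, rfl⟩
  obtain ⟨y, hy, hxy⟩ := h x hx
  rwa [← (hφ _ _).2 hxy]

theorem Small.pair (x y : M) : Small (fun z : M => z = x ∨ z = y) := hM.out.pairing x y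

theorem Small.sUnion (x : M) : Small (fun z : M => ∃ w, Mem w x ∧ Mem z w) := hM.out.union x

theorem Small.power (x : M) : Small (fun z : M => IsSet z ∧ Sub z x) := hM.out.powerset x

theorem Small.iUnion (f : M → M) [DF f] (w : M) :
    Small (fun z : M => ∃ x, Mem x w ∧ Mem z (f x)) := by
  obtain ⟨s, hs, h⟩ := Small.image f w
  obtain ⟨t, ht, h'⟩ := Small.sUnion s
  refine ⟨t, ht, fun z => (h' z).trans ?_⟩
  simp only [h]
  aesop

theorem Small.or {P Q : M → Prop} (hP : Small P) (hQ : Small Q) : Small (fun x => P x ∨ Q x) := by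
  obtain ⟨s, hs, h⟩ := hP
  obtain ⟨t, ht, h'⟩ := hQ
  obtain ⟨p, hp, hp'⟩ := Small.pair s t
  obtain ⟨r, hr, hr'⟩ := Small.sUnion p
  refine ⟨r, hr, fun z => (hr' z).trans ?_⟩
  simp only [hp', ← h, ← h']
  aesop

theorem Small.mem (w : M) : Small (fun x : M => Mem x w) := by
  refine Small.of_subset (w := w) (fun _ h => h)

/-- The unordered pair. -/
noncomputable def upair (x y : M) : M := mkSet (fun z => z = x ∨ z = y)

instance DF.upair (f g : E → M) [DF f] [DF g] : DF (fun e => upair (f e) (g e)) := by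
  unfold UrelementSetTheory.upair; infer_instance

@[simp] theorem mem_upair {x y z : M} : Mem z (upair x y) ↔ z = x ∨ z = y := (Small.pair x y).mem_mk

/-- The Kuratowski pair. -/
noncomputable def opair (x y : M) : M := upair (upair x x) (upair x y)

instance DF.opair (f g : E → M) [DF f] [DF g] : DF (fun e => opair (f e) (g e)) := by
  unfold UrelementSetTheory.opair; infer_instance

theorem upair_eq_upair {x y x' y' : M} (h : upair x y = upair x' y') :
    (x = x' ∧ y = y') ∨ (x = y' ∧ y = x') := by
  have h1 : ∀ z, (z = x ∨ z = y) ↔ (z = x' ∨ z = y') := fun z => by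
    rw [← mem_upair, h, mem_upair]
  have := h1 x; have := h1 y; have := h1 x'; have := h1 y'
  grind

theorem opair_inj {x y x' y' : M} (h : opair x y = opair x' y') : x = x' ∧ y = y' := by
  rcases upair_eq_upair h with ⟨h1, h2⟩ | ⟨h1, h2⟩
  · have := upair_eq_upair h1
    have := upair_eq_upair h2
    grind
  · have := upair_eq_upair h1
    have := upair_eq_upair h2
    grind

/-- The image of a set under a definable function. -/
noncomputable def image (f : M → M) (w : M) : M := mkSet (fun y => ∃ x, Mem x w ∧ y = f x)

theorem mem_image {f : M → M} [DF f] {w y : M} : Mem y (image f w) ↔ ∃ x, Mem x w ∧ y = f x :=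
  (Small.image f w).mem_mk

theorem image_congr {f g : M → M} {w : M} (h : ∀ x, Mem x w → f x = g x) :
    image f w = image g w := by
  have : (fun y : M => ∃ x, Mem x w ∧ y = f x) = fun y : M => ∃ x, Mem x w ∧ y = g x := by
    funext y
    refine propext (exists_congr fun x => and_congr_right fun hx => ?_)
    rw [h x hx]
  rw [image, this, image]

instance DF.image (f : E → M → M) (w : E → M) [hf : DF (fun p : E × M => f p.1 p.2)] [DF w] :
    DF (fun e => image (f e) (w e)) := by
  unfold UrelementSetTheory.image
  have h1 : DF (fun p : (E × M) × M => f p.1.1 p.2) :=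
    hf.comp_pair (fun p : (E × M) × M => p.1.1) (fun p => p.2)
  have h1 : DF (fun p : ((E × M) × M) × M => f p.1.1.1 p.2) :=
    hf.comp_pair (fun p : ((E × M) × M) × M => p.1.1.1) (fun p => p.2)
  infer_instance

instance DF.image_self (f : M → M) [hf : DF f] : DF (UrelementSetTheory.image f) :=
  have := hf.comp (fun p : M × M => p.2)
  DF.image (fun _ => f) (fun x => x)

/-- The value at `x` of the set of pairs `f`. -/
noncomputable def ap (f x : M) : M := the (fun y => Mem (opair x y) f)

instance DF.ap (f g : E → M) [DF f] [DF g] : DF (fun e => ap (f e) (g e)) := by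
  unfold UrelementSetTheory.ap; infer_instance

instance DF.ap_self (f : M) : DF (UrelementSetTheory.ap f) := DF.ap (fun _ => f) (fun x => x)

/-- The restriction of a definable function to a set, as a set of pairs. -/
noncomputable def graph (f : M → M) (w : M) : M := image (fun x => opair x (f x)) w

theorem ap_graph (f : M → M) [DF f] {w x : M} (hx : Mem x w) : ap (graph f w) x = f x := by
  refine the_eq (mem_image.2 ⟨x, hx, rfl⟩) fun y hy => ?_
  obtain ⟨x', -, h⟩ := mem_image.1 hy
  obtain ⟨rfl, h⟩ := opair_inj h
  exact h

/-- The successor `x ∪ {x}`. -/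
noncomputable def succ (x : M) : M := mkSet (fun z => Mem z x ∨ z = x)

instance DF.succ (f : E → M) [DF f] : DF (fun e => succ (f e)) := by
  unfold UrelementSetTheory.succ; infer_instance

theorem Small.eq (x : M) : Small (fun z : M => z = x) := ⟨upair x x, isSet_mk _, by simp⟩

@[simp] theorem mem_succ {x z : M} : Mem z (succ x) ↔ Mem z x ∨ z = x :=
  ((Small.mem x).or (Small.eq x)).mem_mk

theorem isSet_succ (x : M) : IsSet (succ x) := isSet_mk _

instance Def.isTransitiveSet (f : E → M) [DF f] : Def M (fun e => IsTransitiveSet (f e)) := by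
  unfold IsTransitiveSet; infer_instance

instance Def.isTransitiveSet_self : Def M (IsTransitiveSet : M → Prop) :=
  Def.isTransitiveSet (fun x => x)

/-- Foundation for definable subclasses of a set. -/
theorem exists_minimal_of_mem (P : M → Prop) [Def M P] {w x : M} (hx : Mem x w) (hP : P x) :
    ∃ y, Mem y w ∧ P y ∧ ∀ z, Mem z y → Mem z w → ¬ P z := by
  obtain ⟨s, -, h⟩ := Small.sep w P
  obtain ⟨y, hy, hy'⟩ := hM.out.foundation s ⟨x, (h x).2 ⟨hx, hP⟩⟩
  exact ⟨y, ((h y).1 hy).1, ((h y).1 hy).2, fun z hz hzw hPz => hy' z hz ((h z).2 ⟨hzw, hPz⟩)⟩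

theorem not_mem_self (x : M) : ¬ Mem x x := by
  intro h
  obtain ⟨y, -, hyx, hy⟩ := exists_minimal_of_mem (fun y => y = x) h rfl
  exact hy x (by rw [hyx]; exact h) h rfl

end SetOps

/-! ### Membership recursion -/

section Recursion

variable {M : Type u} [lang.Structure M] [hM : Fact (ModelsZFUR M)] {E : Type u} [Ctx M E]

/-- `f` is a set of pairs that on the transitive set `t` satisfies the recursion given by `G`. -/
def Att (G : M → M → M) (t f : M) : Prop :=
  IsTransitiveSet t ∧ ∀ y, Mem y t → ap f y = G y (image (fun z => ap f z) y)

/-- The function defined by `F x = G x {F y | y ∈ x}`. -/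
noncomputable def recF (G : M → M → M) (x : M) : M :=
  the (fun y => ∃ t f, Att G t f ∧ Mem x t ∧ y = ap f x)

instance Def.att (G : E → M → M → M) (t f : E → M)
    [hG : DF (fun p : (E × M) × M => G p.1.1 p.1.2 p.2)] [DF t] [DF f] :
    Def M (fun e => Att (G e) (t e) (f e)) := by
  unfold Att
  have h1 : DF (fun p : (E × M) => G p.1 p.2 (image (fun z => ap (f p.1) z) p.2)) :=
    DF.subst (E := E × M) (g := fun p x => G p.1 p.2 x) hG inferInstance
  infer_instance

instance DF.recF (G : E → M → M → M) (x : E → M)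
    [hG : DF (fun p : (E × M) × M => G p.1.1 p.1.2 p.2)] [DF x] :
    DF (fun e => recF (G e) (x e)) := by
  unfold UrelementSetTheory.recF
  have h1 : DF (fun p : ((((E × M) × M) × M) × M) × M => G p.1.1.1.1.1 p.1.2 p.2) :=
    DF.subst₃ (f := G) hG (fun p : ((((E × M) × M) × M) × M) × M => p.1.1.1.1.1)
      (fun p => p.1.2) (fun p => p.2)
  have h2 : Def M (fun p : ((E × M) × M) × M => Att (G p.1.1.1) p.1.2 p.2) :=
    Def.att (fun p : ((E × M) × M) × M => G p.1.1.1) _ _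
  infer_instance

variable {G : M → M → M}

theorem Def.att_closed [hG : DF (fun p : M × M => G p.1 p.2)] : Def M (fun p : M × M => Att G p.1 p.2) := by
  have := DF.comp_pair (f := G) hG (fun p : ((M × M) × M) × M => p.1.2) (fun p => p.2)
  exact Def.att (fun _ : M × M => G) _ _

theorem DF.recF_closed [hG : DF (fun p : M × M => G p.1 p.2)] : DF (fun x : M => UrelementSetTheory.recF G x) := by
  have := DF.comp_pair (f := G) hG (fun p : (M × M) × M => p.1.2) (fun p => p.2)
  exact DF.recF (fun _ : M => G) _

/-- At an ∈-minimal disagreement both attempts apply G to the same image, so they agree after all.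
-/
theorem Att.unique {t f t' f' : M} (h : Att G t f) (h' : Att G t' f') {x : M} (hx : Mem x t)
    (hx' : Mem x t') : ap f x = ap f' x := by
  by_contra hne
  obtain ⟨y, hy, ⟨hy', hne'⟩, hmin⟩ := exists_minimal_of_mem
    (fun x => Mem x t' ∧ ap f x ≠ ap f' x) hx ⟨hx', hne⟩
  apply hne'
  rw [h.2 y hy, h'.2 y hy']
  congr 1
  refine image_congr fun z hz => ?_
  by_contra hz'
  exact hmin z hz (h.1.mem_trans hz hy) ⟨h'.1.mem_trans hz hy', hz'⟩

theorem Att.recF_eq {t f x : M} (h : Att G t f) (hx : Mem x t) : recF G x = ap f x := by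
  refine the_eq ⟨t, f, h, hx, rfl⟩ ?_
  rintro y ⟨t', f', h', hx', rfl⟩
  exact h'.unique h hx' hx

theorem Att.recF_rec {t f x : M} (h : Att G t f) (hx : Mem x t) :
    recF G x = G x (image (recF G) x) := by
  rw [h.recF_eq hx, h.2 x hx]
  congr 1
  exact image_congr fun z hz => (h.recF_eq (h.1.mem_trans hz hx)).symm

variable [hG : DF (fun p : M × M => G p.1 p.2)]

/-- At an ∈-minimal failure y, the members of T covered by attempts form, together with y, a
transitive set. The recursion equation already holds at all members of its elements, so one more
application of G yields an attempt covering y. The ambient T is needed because transitive closures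
are themselves obtained by recursion, along ω. -/
theorem exists_att {T x : M} (hT : IsTransitiveSet T) (hx : Mem x T) :
    ∃ t f, Att G t f ∧ Mem x t := by
  have d1 : Def M (fun p : (M × M) × M => Att G p.1.2 p.2) :=
    Def.comp_pair (P := Att G) Def.att_closed (fun p : (M × M) × M => p.1.2) (fun p => p.2)
  have d2 : DF (fun x : M => recF G x) := DF.recF_closed
  by_contra hne
  obtain ⟨y, hy, hne', hmin⟩ := exists_minimal_of_mem
    (fun x => ¬ ∃ t f, Att G t f ∧ Mem x t) hx hne
  simp only [not_not] at hmin
  apply hne'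
  have hD : Small (fun x => Mem x T ∧ ∃ t f, Att G t f ∧ Mem x t) := Small.sep _ _
  obtain ⟨t', ht', ht⟩ := hD.or (Small.eq y)
  have d3 : DF (fun z : M => G z (image (fun z => recF G z) z)) :=
    DF.subst (E := M) hG inferInstance
  have key : ∀ z, Mem z t' → ∀ w, Mem w z → Mem w t' ∧ recF G w = G w (image (recF G) w) := by
    intro z hz w hw
    rcases (ht z).1 hz with ⟨hzT, t, f, hf, hzt⟩ | rfl
    · have hwt := hf.1.mem_trans hw hzt
      exact ⟨(ht w).2 (Or.inl ⟨hT.mem_trans hw hzT, t, f, hf, hwt⟩), hf.recF_rec hwt⟩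
    · have hwT := hT.mem_trans hw hy
      obtain ⟨t, f, hf, hwt⟩ := hmin w hw hwT
      exact ⟨(ht w).2 (Or.inl ⟨hwT, t, f, hf, hwt⟩), hf.recF_rec hwt⟩
  refine ⟨t', graph (fun z => G z (image (recF G) z)) t',
    ⟨⟨ht', fun z hz w hw => (key z hz w hw).1⟩, fun z hz => ?_⟩, (ht y).2 (Or.inr rfl)⟩
  rw [ap_graph _ hz]
  congr 1
  refine image_congr fun w hw => ?_
  rw [ap_graph _ (key z hz w hw).1]
  exact (key z hz w hw).2

theorem recF_rec_of_mem {T x : M} (hT : IsTransitiveSet T) (hx : Mem x T) :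
    recF G x = G x (image (recF G) x) := by
  obtain ⟨t, f, h, hx⟩ := exists_att (G := G) hT hx
  exact h.recF_rec hx

end Recursion

/-! ### Natural numbers, transitive closure and full recursion -/

section Omega

variable {M : Type u} [lang.Structure M] [hM : Fact (ModelsZFUR M)]

/-- `s` contains the empty set and is closed under successors. -/
def Inductive (s : M) : Prop := Mem (emp M) s ∧ ∀ x, Mem x s → Mem (succ x) s

instance Def.inductive {E : Type u} [Ctx M E]  (f : E → M) [DF f] :
    Def M (fun e => Inductive (f e)) := by
  unfold Inductive; infer_instance

theorem exists_inductive : ∃ s : M, Inductive s := by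
  obtain ⟨s, -, ⟨e, he, he', h0⟩, h⟩ := hM.out.infinity
  refine ⟨s, ?_, fun x hx => ?_⟩
  · have : e = emp M := set_ext he' isSet_emp fun z =>
      ⟨fun h => absurd h (h0 z), fun h => absurd h (not_mem_emp z)⟩
    rwa [← this]
  · obtain ⟨y, hy, hy', h'⟩ := h x hx
    rwa [← set_ext hy' (isSet_succ x) fun z => (h' z).trans mem_succ.symm]

variable (M) in
/-- The set of natural numbers. -/
noncomputable def omega : M := mkSet (fun n => ∀ s, Inductive s → Mem n s)

theorem mem_omega {n : M} : Mem n (omega M) ↔ ∀ s, Inductive s → Mem n s := by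
  obtain ⟨s, hs⟩ := exists_inductive (M := M)
  exact (Small.of_subset (w := s) fun n hn => hn s hs : Small _).mem_mk

theorem emp_mem_omega : Mem (emp M) (omega M) := mem_omega.2 fun _ hs => hs.1

theorem succ_mem_omega {n : M} (hn : Mem n (omega M)) : Mem (succ n) (omega M) :=
  mem_omega.2 fun s hs => hs.2 n (mem_omega.1 hn s hs)

theorem omega_induction (P : M → Prop) [Def M P] (h0 : P (emp M))
    (h1 : ∀ n, Mem n (omega M) → P n → P (succ n)) {n : M} (hn : Mem n (omega M)) : P n := by
  obtain ⟨s, -, hs⟩ := Small.sep (omega M) P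
  refine ((hs n).1 (mem_omega.1 hn s ⟨(hs _).2 ⟨emp_mem_omega, h0⟩, fun x hx => ?_⟩)).2
  obtain ⟨hx, hPx⟩ := (hs x).1 hx
  exact (hs _).2 ⟨succ_mem_omega hx, h1 x hx hPx⟩

theorem isTransitiveSet_omega : IsTransitiveSet (omega M) := by
  refine ⟨isSet_mk _, fun n hn => ?_⟩
  refine omega_induction (fun n => Sub n (omega M)) (fun z hz => absurd hz (not_mem_emp z)) ?_ hn
  intro n hn h z hz
  rcases mem_succ.1 hz with h' | rfl
  exacts [h z h', hn]

theorem isTransitiveSet_of_mem_omega {n : M} (hn : Mem n (omega M)) : IsTransitiveSet n := by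
  refine omega_induction (fun n => IsTransitiveSet n) ⟨isSet_emp, fun z hz => absurd hz
    (not_mem_emp z)⟩ ?_ hn
  intro n _ h
  refine ⟨isSet_succ n, fun y hy z hz => mem_succ.2 (Or.inl ?_)⟩
  rcases mem_succ.1 hy with h' | rfl
  exacts [h.mem_trans hz h', hz]

/-- Iteration: the union of the stages of `F n = x ∪ ⋃ {H (F m) | m ∈ n}` is closed under `H`. -/
theorem exists_iterate (H : M → M) [dH : DF H] (x : M) : ∃ F : M → M, DF F ∧
    ∀ n, Mem n (omega M) → IsSet (F n) ∧
      ∀ z, Mem z (F n) ↔ Mem z x ∨ ∃ m, Mem m n ∧ Mem z (H (F m)) := by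
  let G : M → M → M := fun _ i => mkSet (fun z => Mem z x ∨ ∃ v, Mem v i ∧ Mem z (H v))
  have hG : DF (fun p : M × M => G p.1 p.2) := by
    dsimp only [G]
    have : DF (fun p : ((M × M) × M) × M => H p.2) := dH.comp _
    infer_instance
  have hF : DF (fun n => recF G n) := DF.recF_closed
  refine ⟨recF G, hF, fun n hn => ?_⟩
  rw [recF_rec_of_mem isTransitiveSet_omega hn]
  refine ⟨isSet_mk _, fun z => ?_⟩
  refine (((Small.mem x).or (Small.iUnion H _)).mem_mk).trans (or_congr_right ?_)
  have : DF (recF G) := hF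
  simp only [mem_image]
  aesop

/-- Iterate the union operation ω times. This recursion runs along ω, which is already known to be
transitive, so there is no circularity. -/
theorem exists_transitive_superset (x : M) : ∃ t : M, IsTransitiveSet t ∧ Sub x t := by
  have d : DF (fun v : M => mkSet (fun z => ∃ w, Mem w v ∧ Mem z w)) := inferInstance
  obtain ⟨F, hF, h⟩ := exists_iterate (fun v : M => mkSet (fun z => ∃ w, Mem w v ∧ Mem z w)) x
  obtain ⟨t, ht, ht'⟩ := Small.iUnion F (omega M)
  refine ⟨t, ⟨ht, fun y hy z hz => ?_⟩, fun z hz => ?_⟩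
  · obtain ⟨n, hn, hy⟩ := (ht' y).1 hy
    refine (ht' z).2 ⟨succ n, succ_mem_omega hn, ((h _ (succ_mem_omega hn)).2 z).2 (Or.inr
      ⟨n, mem_succ.2 (Or.inr rfl), (Small.sUnion _).mem_mk.2 ⟨y, hy, hz⟩⟩)⟩
  · exact (ht' z).2 ⟨_, emp_mem_omega, ((h _ emp_mem_omega).2 z).2 (Or.inl hz)⟩

theorem exists_transitive_mem (x : M) : ∃ t : M, IsTransitiveSet t ∧ Mem x t := by
  obtain ⟨t, ht, h⟩ := exists_transitive_superset (upair x x)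
  exact ⟨t, ht, h x (mem_upair.2 (Or.inl rfl))⟩

theorem recF_rec (G : M → M → M) [DF (fun p : M × M => G p.1 p.2)] (x : M) :
    recF G x = G x (image (recF G) x) := by
  obtain ⟨t, ht, h⟩ := exists_transitive_mem x
  exact recF_rec_of_mem ht h

theorem mem_induction (P : M → Prop) [Def M P] (h : ∀ x, (∀ y, Mem y x → P y) → P x) (x : M) :
    P x := by
  obtain ⟨t, ht, hx⟩ := exists_transitive_mem x
  by_contra hne
  obtain ⟨y, hy, hne', hmin⟩ := exists_minimal_of_mem (fun x => ¬ P x) hx hne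
  exact hne' (h y fun z hz => not_not.1 (hmin z hz (ht.mem_trans hz hy)))

end Omega

/-! ### Ordinals -/

section Basic

variable {M : Type u} [lang.Structure M]

/-- `x` is an ordinal: a transitive set of transitive sets. -/
def IsOrd (x : M) : Prop := IsTransitiveSet x ∧ ∀ y, Mem y x → IsTransitiveSet y

theorem IsOrd.mem {x y : M} (hx : IsOrd x) (hy : Mem y x) : IsOrd y :=
  ⟨hx.2 y hy, fun z hz => hx.2 z (hx.1.mem_trans hz hy)⟩

theorem IsOrd.isSet {x : M} (hx : IsOrd x) : IsSet x := hx.1.1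

theorem IsOrd.mem_trans {x y z : M} (hz : IsOrd z) (hx : Mem x y) (hy : Mem y z) : Mem x z :=
  hz.1.mem_trans hx hy

theorem isOrd_of_forall {s : M} (hs : IsTransitiveSet s) (h : ∀ x, Mem x s → IsOrd x) : IsOrd s :=
  ⟨hs, fun x hx => (h x hx).1⟩

end Basic

section Ordinals

variable {M : Type u} [lang.Structure M] [hM : Fact (ModelsZFUR M)]

instance Def.isOrd {E : Type u} [Ctx M E] (f : E → M) [DF f] : Def M (fun e => IsOrd (f e)) := by
  unfold IsOrd; infer_instance

instance Def.isOrd_self : Def M (IsOrd : M → Prop) := Def.isOrd (fun x => x)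

theorem IsOrd.trichotomy {x y : M} (hx : IsOrd x) (hy : IsOrd y) : Mem x y ∨ x = y ∨ Mem y x := by
  suffices ∀ x : M, IsOrd x → ∀ y, IsOrd y → (Mem x y ∨ x = y ∨ Mem y x) from this x hx y hy
  clear hx hy x y
  refine mem_induction _ fun x ihx hx => ?_
  refine mem_induction _ fun y ihy hy => ?_
  by_contra! hne
  obtain ⟨h1, h2, h3⟩ := hne
  refine h2 (set_ext hx.isSet hy.isSet fun z => ⟨fun hz => ?_, fun hz => ?_⟩)
  · rcases ihx z hz (hx.mem hz) y hy with h | rfl | h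
    exacts [h, absurd hz h3, absurd (hx.mem_trans h hz) h3]
  · rcases ihy z hz (hy.mem hz) with h | rfl | h
    exacts [absurd (hy.mem_trans h hz) h1, absurd hz h1, h]

theorem IsOrd.sub_of_not_mem {x y : M} (hx : IsOrd x) (hy : IsOrd y) (h : ¬ Mem x y) : Sub y x := by
  rcases hx.trichotomy hy with h' | rfl | h'
  exacts [absurd h' h, Sub.refl _, hx.1.2 y h']

theorem exists_least (P : M → Prop) [Def M P] (h : ∃ a, IsOrd a ∧ P a) :
    ∃ a, IsOrd a ∧ P a ∧ ∀ b, Mem b a → ¬ P b := by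
  by_contra! hne
  obtain ⟨a, ha, hPa⟩ := h
  refine mem_induction (fun a => IsOrd a → ¬ P a) (fun x ih hx hPx => ?_) a ha hPa
  obtain ⟨b, hb, hPb⟩ := hne x hx hPx
  exact ih b hb (hx.mem hb) hPb

theorem IsOrd.succ {x : M} (hx : IsOrd x) : IsOrd (succ x) := by
  refine isOrd_of_forall ⟨isSet_succ x, fun y hy z hz => mem_succ.2 (Or.inl ?_)⟩ fun y hy => ?_
  · rcases mem_succ.1 hy with h | rfl
    exacts [hx.mem_trans hz h, hz]
  · rcases mem_succ.1 hy with h | rfl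
    exacts [hx.mem h, hx]

theorem mem_succ_self (x : M) : Mem x (succ x) := mem_succ.2 (Or.inr rfl)

theorem isOrd_emp : IsOrd (emp M) :=
  ⟨⟨isSet_emp, fun _ hy => absurd hy (not_mem_emp _)⟩, fun _ hy => absurd hy (not_mem_emp _)⟩

theorem isOrd_of_mem_omega {n : M} (hn : Mem n (omega M)) : IsOrd n :=
  ⟨isTransitiveSet_of_mem_omega hn, fun _ hy => isTransitiveSet_of_mem_omega
    (isTransitiveSet_omega.mem_trans hy hn)⟩

theorem exists_ord_bound (f : M → M) [DF f] (w : M) (hf : ∀ x, Mem x w → IsOrd (f x)) :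
    ∃ β, IsOrd β ∧ ∀ x, Mem x w → Mem (f x) β := by
  have : DF (fun x => succ (f x)) := inferInstance
  obtain ⟨β, hβ, h⟩ := Small.iUnion (fun x => succ (f x)) w
  refine ⟨β, isOrd_of_forall ⟨hβ, fun y hy z hz => ?_⟩ fun y hy => ?_,
    fun x hx => (h _).2 ⟨x, hx, mem_succ_self _⟩⟩
  · obtain ⟨x, hx, hyx⟩ := (h y).1 hy
    exact (h z).2 ⟨x, hx, (hf x hx).succ.mem_trans hz hyx⟩
  · obtain ⟨x, hx, hyx⟩ := (h y).1 hy
    exact (hf x hx).succ.mem hyx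

/-- The Burali-Forti argument. -/
theorem not_forall_ord_mem (w : M) : ¬ ∀ x, IsOrd x → Mem x w := by
  intro h
  obtain ⟨s, hs, hs'⟩ := Small.of_subset (P := fun x : M => IsOrd x) h
  have ho : IsOrd s := isOrd_of_forall
    ⟨hs, fun y hy z hz => (hs' z).2 (((hs' y).1 hy).mem hz)⟩ fun x hx => (hs' x).1 hx
  exact not_mem_self s ((hs' s).2 ho)

theorem exists_ord_mem₂ {x y : M} (hx : IsOrd x) (hy : IsOrd y) :
    ∃ z, IsOrd z ∧ Mem x z ∧ Mem y z := by
  rcases hx.trichotomy hy with h | rfl | h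
  · exact ⟨succ y, hy.succ, mem_succ.2 (Or.inl h), mem_succ_self y⟩
  · exact ⟨succ x, hx.succ, mem_succ_self x, mem_succ_self x⟩
  · exact ⟨succ x, hx.succ, mem_succ_self x, mem_succ.2 (Or.inl h)⟩

/-- The least ordinal with the property `P`. -/
noncomputable def leastOrd (P : M → Prop) : M :=
  the (fun a => (IsOrd a ∧ P a) ∧ ∀ b, Mem b a → ¬ P b)

theorem leastOrd_spec (P : M → Prop) [Def M P] (h : ∃ a, IsOrd a ∧ P a) :
    (IsOrd (leastOrd P) ∧ P (leastOrd P)) ∧ ∀ b, Mem b (leastOrd P) → ¬ P b := by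
  obtain ⟨a, ha, hP, hmin⟩ := exists_least P h
  refine the_spec (P := fun a => (IsOrd a ∧ P a) ∧ ∀ b, Mem b a → ¬ P b)
    ⟨a, ⟨⟨ha, hP⟩, hmin⟩, ?_⟩
  rintro b ⟨⟨hb, hPb⟩, hminb⟩
  rcases ha.trichotomy hb with h | h | h
  exacts [absurd hP (hminb a h), h.symm, absurd hPb (hmin b h)]

instance DF.leastOrd {E : Type u} [Ctx M E] (P : E → M → Prop)
    [hP : Def M (fun p : E × M => P p.1 p.2)] : DF (fun e => leastOrd (P e)) := by
  unfold UrelementSetTheory.leastOrd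
  have h1 : Def M (fun p : (E × M) × M => P p.1.1 p.2) :=
    hP.comp_pair (fun p : (E × M) × M => p.1.1) (fun p => p.2)
  infer_instance

/-- Taking the least γ turns the relation into a function, so Replacement does the work of
Collection. -/
theorem exists_ord_bound_of_exists (Q : M → M → Prop) [hQ : Def M (fun p : M × M => Q p.1 p.2)]
    (w : M) (h : ∀ x, Mem x w → ∃ γ, IsOrd γ ∧ Q x γ) :
    ∃ β, IsOrd β ∧ ∀ x, Mem x w → ∃ γ, Mem γ β ∧ Q x γ := by
  have hx : ∀ x, Def M (Q x) := fun x => hQ.comp_pair (fun _ : M => x) (fun y => y)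
  obtain ⟨β, hβ, hb⟩ := exists_ord_bound (fun x => leastOrd (Q x)) w
    fun x hx => (leastOrd_spec (Q x) (h x hx)).1.1
  exact ⟨β, hβ, fun x hx => ⟨_, hb x hx, (leastOrd_spec (Q x) (h x hx)).1.2⟩⟩

/-- By induction on the length: bound over the first coordinate for each fixed tail, then bound
these bounds over all tails. -/
theorem exists_ord_bound_fin (w : M) : ∀ (n : ℕ) (Q : (Fin n → M) → M → Prop)
    [Def M (fun p : (Fin n → M) × M => Q p.1 p.2)],
    (∀ v : Fin n → M, (∀ i, Mem (v i) w) → ∃ γ, IsOrd γ ∧ Q v γ) →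
    ∃ β, IsOrd β ∧ ∀ v : Fin n → M, (∀ i, Mem (v i) w) → ∃ γ, Mem γ β ∧ Q v γ
  | 0, Q, hQ, h => by
    obtain ⟨γ, hγ, hQγ⟩ := h default (fun i => i.elim0)
    exact ⟨succ γ, hγ.succ, fun v _ => ⟨γ, mem_succ_self γ, by rwa [Subsingleton.elim v default]⟩⟩
  | n + 1, Q, hQ, h => by
    have hcons : IsProj M (fun p : ((Fin n → M) × M) × M =>
        ((Fin.cons p.2 p.1.1 : Fin (n + 1) → M), p.1.2)) := by
      refine ⟨?_⟩
      rintro t (⟨s, (⟨i, rfl⟩ | ⟨c, rfl⟩), rfl⟩ | ⟨s, hs, rfl⟩)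
      · refine Fin.cases ?_ (fun j => ?_) i
        · exact Or.inr ⟨id, Or.inl rfl, rfl⟩
        · exact Or.inl ⟨_, Or.inl ⟨_, Or.inl ⟨j, rfl⟩, rfl⟩, rfl⟩
      · exact Ctx.const_mem c
      · exact Or.inl ⟨_, Or.inr ⟨s, hs, rfl⟩, rfl⟩
    have h1 : Def M (fun p : ((Fin n → M) × M) × M => Q (Fin.cons p.2 p.1.1) p.1.2) :=
      hQ.comp (fun p : ((Fin n → M) × M) × M => ((Fin.cons p.2 p.1.1 : Fin (n + 1) → M), p.1.2))
    have h2 : ∀ v : Fin n → M, Def M (fun p : M × M => Q (Fin.cons p.1 v) p.2) := by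
      intro v
      have : IsProj M (fun p : M × M => ((Fin.cons p.1 v : Fin (n + 1) → M), p.2)) := by
        refine ⟨?_⟩
        rintro t (⟨s, (⟨i, rfl⟩ | ⟨c, rfl⟩), rfl⟩ | ⟨s, hs, rfl⟩)
        · refine Fin.cases ?_ (fun j => ?_) i
          · exact Or.inl ⟨id, Or.inl rfl, rfl⟩
          · exact Ctx.const_mem (v j)
        · exact Ctx.const_mem c
        · exact Or.inr ⟨s, hs, rfl⟩
      exact hQ.comp (fun p : M × M => ((Fin.cons p.1 v : Fin (n + 1) → M), p.2))
    have h3 : Def M (fun p : (((Fin n → M) × M) × M) × M => Q (Fin.cons p.1.2 p.1.1.1) p.2) := by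
      have := IsProj.pair (M := M) (E := (((Fin n → M) × M) × M) × M)
        (fun p => p.1.1.1) (fun p => p.2)
      have := IsProj.pair (M := M) (E := (((Fin n → M) × M) × M) × M)
        (fun p => (p.1.1.1, p.2)) (fun p => p.1.2)
      exact h1.comp (fun p : (((Fin n → M) × M) × M) × M => ((p.1.1.1, p.2), p.1.2))
    obtain ⟨β, hβ, hb⟩ := exists_ord_bound_fin w n
      (fun v β => ∀ a, Mem a w → ∃ γ, Mem γ β ∧ Q (Fin.cons a v) γ)
      fun v hv => exists_ord_bound_of_exists (fun a γ => Q (Fin.cons a v) γ) w fun a ha =>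
        h _ (Fin.cases ha hv)
    refine ⟨β, hβ, fun v hv => ?_⟩
    obtain ⟨γ, hγ, hγ'⟩ := hb (Fin.tail v) fun i => hv i.succ
    obtain ⟨δ, hδ, hQδ⟩ := hγ' (v 0) (hv 0)
    exact ⟨δ, hβ.mem_trans hδ hγ, by rwa [Fin.cons_self_tail] at hQδ⟩

theorem exists_ord_bound_pi {ι : Type} [Finite ι] (w : M) (Q : (ι → M) → M → Prop)
    [hQ : Def M (fun p : (ι → M) × M => Q p.1 p.2)]
    (h : ∀ v : ι → M, (∀ i, Mem (v i) w) → ∃ γ, IsOrd γ ∧ Q v γ) :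
    ∃ β, IsOrd β ∧ ∀ v : ι → M, (∀ i, Mem (v i) w) → ∃ γ, Mem γ β ∧ Q v γ := by
  obtain ⟨n, ⟨e⟩⟩ := Finite.exists_equiv_fin ι
  have : IsProj M (fun p : (Fin n → M) × M => ((p.1 ∘ e : ι → M), p.2)) := by
    refine ⟨?_⟩
    rintro t (⟨s, (⟨i, rfl⟩ | ⟨c, rfl⟩), rfl⟩ | ⟨s, hs, rfl⟩)
    · exact Or.inl ⟨_, Or.inl ⟨e i, rfl⟩, rfl⟩
    · exact Ctx.const_mem c
    · exact Or.inr ⟨s, hs, rfl⟩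
  have h1 : Def M (fun p : (Fin n → M) × M => Q (p.1 ∘ e) p.2) :=
    hQ.comp (fun p : (Fin n → M) × M => ((p.1 ∘ e : ι → M), p.2))
  obtain ⟨β, hβ, hb⟩ := exists_ord_bound_fin w n (fun v γ => Q (v ∘ e) γ)
    fun v hv => h _ fun i => hv _
  refine ⟨β, hβ, fun v hv => ?_⟩
  obtain ⟨γ, hγ, hQγ⟩ := hb (v ∘ e.symm) fun i => hv _
  exact ⟨γ, hγ, by simpa [Function.comp_assoc] using hQγ⟩

/-- Let g α be the least β with W α β. Starting from `succ α₀`, adjoin all ordinals up to the values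
of g, ω times; κ is the union of the stages, and g maps each stage into the next. -/
theorem exists_closed_ord (W : M → M → Prop) [hW : Def M (fun p : M × M => W p.1 p.2)]
    (h : ∀ α, IsOrd α → ∃ β, IsOrd β ∧ W α β) {α₀ : M} (hα₀ : IsOrd α₀) :
    ∃ κ, IsOrd κ ∧ Mem α₀ κ ∧ ∀ α, Mem α κ → ∃ β, Mem β κ ∧ W α β := by
  have hx : ∀ x, Def M (W x) := fun x => hW.comp_pair (fun _ : M => x) (fun y => y)
  let g : M → M := fun α => leastOrd (W α)
  have hg : ∀ α, IsOrd α → IsOrd (g α) ∧ W α (g α) := fun α hα =>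
    (leastOrd_spec (W α) (h α hα)).1
  have dg : DF g := inferInstanceAs (DF (fun α => leastOrd (W α)))
  have dH : DF (fun v : M => mkSet (fun z => ∃ α, Mem α v ∧ Mem z (succ (g α)))) := inferInstance
  obtain ⟨F, dF, hF⟩ := exists_iterate
    (fun v : M => mkSet (fun z => ∃ α, Mem α v ∧ Mem z (succ (g α)))) (succ α₀)
  have hF' : ∀ n, Mem n (omega M) → ∀ z, Mem z (F n) ↔ Mem z (succ α₀) ∨
      ∃ m, Mem m n ∧ ∃ α, Mem α (F m) ∧ Mem z (succ (g α)) := by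
    intro n hn z
    rw [(hF n hn).2 z]
    simp only [(Small.iUnion (fun α => succ (g α)) _).mem_mk]
  have hord : ∀ n, Mem n (omega M) → ∀ z, Mem z (F n) → IsOrd z := by
    refine mem_induction _ fun n ih hn z hz => ?_
    rcases (hF' n hn z).1 hz with hz | ⟨m, hm, α, hα, hz⟩
    · exact hα₀.succ.mem hz
    · exact (hg α (ih m hm (isTransitiveSet_omega.mem_trans hm hn) α hα)).1.succ.mem hz
  obtain ⟨κ, hκ, hκ'⟩ := Small.iUnion F (omega M)
  refine ⟨κ, isOrd_of_forall ⟨hκ, fun y hy z hz => ?_⟩ fun x hx => ?_, ?_, fun α hα => ?_⟩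
  · obtain ⟨n, hn, hy⟩ := (hκ' y).1 hy
    refine (hκ' z).2 ⟨n, hn, (hF' n hn z).2 ?_⟩
    rcases (hF' n hn y).1 hy with hy | ⟨m, hm, α, hα, hy⟩
    · exact Or.inl (hα₀.succ.mem_trans hz hy)
    · exact Or.inr ⟨m, hm, α, hα, (hg α (hord m (isTransitiveSet_omega.mem_trans hm hn)
        α hα)).1.succ.mem_trans hz hy⟩
  · obtain ⟨n, hn, hx⟩ := (hκ' x).1 hx
    exact hord n hn x hx
  · exact (hκ' _).2 ⟨_, emp_mem_omega, (hF' _ emp_mem_omega _).2 (Or.inl (mem_succ_self _))⟩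
  · obtain ⟨n, hn, hα'⟩ := (hκ' α).1 hα
    exact ⟨g α, (hκ' _).2 ⟨succ n, succ_mem_omega hn, (hF' _ (succ_mem_omega hn) _).2
      (Or.inr ⟨n, mem_succ_self n, α, hα', mem_succ_self _⟩)⟩, (hg α (hord n hn α hα')).2⟩

end Ordinals

/-! ### The cumulative hierarchy over a set, and kernels -/

section Hierarchy

variable {M : Type u} [lang.Structure M] [hM : Fact (ModelsZFUR M)] {E : Type u} [Ctx M E]

/-- The power set. -/
noncomputable def power (x : M) : M := mkSet (fun z => IsSet z ∧ Sub z x)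

theorem mem_power {x z : M} : Mem z (power x) ↔ IsSet z ∧ Sub z x := (Small.power x).mem_mk

instance DF.power (f : E → M) [DF f] : DF (fun e => power (f e)) := by
  unfold UrelementSetTheory.power; infer_instance

instance DF.power_self : DF (UrelementSetTheory.power : M → M) := DF.power (fun x => x)

/-- The cumulative hierarchy over the set `A`: `V A α = A ∪ ⋃ {P (V A β) | β ∈ α}`. -/
noncomputable def V (A α : M) : M :=
  recF (fun _ i => mkSet (fun z => Mem z A ∨ ∃ v, Mem v i ∧ Mem z (power v))) α

instance DF.V (f g : E → M) [DF f] [DF g] : DF (fun e => V (f e) (g e)) := by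
  unfold UrelementSetTheory.V; infer_instance

instance DF.V_self (A : M) : DF (UrelementSetTheory.V A) := DF.V (fun _ => A) (fun x => x)

theorem mem_V {A α z : M} :
    Mem z (V A α) ↔ Mem z A ∨ ∃ β, Mem β α ∧ IsSet z ∧ Sub z (V A β) := by
  have h : V A α = mkSet (fun z => Mem z A ∨ ∃ v, Mem v (image (V A) α) ∧ Mem z (power v)) :=
    recF_rec (fun _ i => mkSet (fun z => Mem z A ∨ ∃ v, Mem v i ∧ Mem z (power v))) α
  rw [h, ((Small.mem A).or (Small.iUnion power _)).mem_mk]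
  simp only [mem_image, mem_power]
  aesop

theorem isSet_V (A α : M) : IsSet (V A α) := by
  rw [V, recF_rec]; exact isSet_mk _

theorem V_mono_left {A A' : M} (h : Sub A A') (α : M) : Sub (V A α) (V A' α) := by
  refine mem_induction (fun α => Sub (V A α) (V A' α)) (fun α ih z hz => ?_) α
  rcases mem_V.1 hz with hz | ⟨β, hβ, hz, hz'⟩
  exacts [mem_V.2 (Or.inl (h z hz)), mem_V.2 (Or.inr ⟨β, hβ, hz, hz'.trans (ih β hβ)⟩)]

theorem V_mono_right (A : M) {α β : M} (h : Sub α β) : Sub (V A α) (V A β) := by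
  intro z hz
  rcases mem_V.1 hz with hz | ⟨γ, hγ, hz⟩
  exacts [mem_V.2 (Or.inl hz), mem_V.2 (Or.inr ⟨γ, h γ hγ, hz⟩)]

theorem IsOrd.V_mono (A : M) {α β : M} (hβ : IsOrd β) (h : Mem α β) : Sub (V A α) (V A β) :=
  V_mono_right A (hβ.1.2 α h)

theorem isTransitiveSet_V {A α : M} (hA : ∀ a, Mem a A → Ur a) (hα : IsOrd α) :
    IsTransitiveSet (V A α) := by
  refine ⟨isSet_V A α, fun y hy z hz => ?_⟩
  rcases mem_V.1 hy with hy | ⟨β, hβ, -, hy⟩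
  exacts [absurd hz (hA y hy).not_mem, hα.V_mono A hβ z (hy z hz)]

theorem mem_of_ur_mem_V {A α u : M} (hu : Ur u) (h : Mem u (V A α)) : Mem u A := by
  rcases mem_V.1 h with h | ⟨β, -, h, -⟩
  exacts [h, absurd hu h]

theorem exists_mem_V {A x : M} (hx : IsSet x)
    (h : ∀ y, Mem y x → ∃ α, IsOrd α ∧ Mem y (V A α)) : ∃ α, IsOrd α ∧ Mem x (V A α) := by
  obtain ⟨β, hβ, hb⟩ := exists_ord_bound_of_exists (fun y α => Mem y (V A α)) x h
  refine ⟨succ β, hβ.succ, mem_V.2 (Or.inr ⟨β, mem_succ_self β, hx, fun y hy => ?_⟩)⟩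
  obtain ⟨γ, hγ, hy⟩ := hb y hy
  exact hβ.V_mono A hγ y hy

/-- The urelements in the transitive closure of `{x}`. -/
noncomputable def ker (x : M) : M :=
  recF (fun x i => mkSet (fun u => (u = x ∧ Ur x) ∨ ∃ v, Mem v i ∧ Mem u v)) x

instance DF.ker (f : E → M) [DF f] : DF (fun e => ker (f e)) := by
  unfold UrelementSetTheory.ker; infer_instance

instance DF.ker_self : DF (UrelementSetTheory.ker : M → M) := DF.ker (fun x => x)

theorem mem_ker {x u : M} : Mem u (ker x) ↔ (u = x ∧ Ur x) ∨ ∃ y, Mem y x ∧ Mem u (ker y) := by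
  have h : ker x = mkSet (fun u => (u = x ∧ Ur x) ∨ ∃ v, Mem v (image ker x) ∧ Mem u v) :=
    recF_rec (fun x i => mkSet (fun u => (u = x ∧ Ur x) ∨ ∃ v, Mem v i ∧ Mem u v)) x
  have h1 : Small (fun u => u = x ∧ Ur x) := Small.of_subset (w := upair x x) fun u hu =>
    mem_upair.2 (Or.inl hu.1)
  rw [h, (h1.or (Small.sUnion _)).mem_mk]
  simp only [mem_image]
  aesop

theorem isSetOfUr_ker (x : M) : IsSetOfUr (ker x) := by
  refine ⟨by rw [ker, recF_rec]; exact isSet_mk _, ?_⟩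
  refine mem_induction (fun x => ∀ u, Mem u (ker x) → Ur u) (fun x ih u hu => ?_) x
  rcases mem_ker.1 hu with ⟨rfl, h⟩ | ⟨y, hy, h⟩
  exacts [h, ih y hy u h]

/-- By ∈-induction: the kernels of the members of x lie in ker x, and the least ranks of the members
are bounded by Replacement. -/
theorem exists_mem_V_ker (x : M) : ∃ α, IsOrd α ∧ Mem x (V (ker x) α) := by
  refine mem_induction (fun x => ∃ α, IsOrd α ∧ Mem x (V (ker x) α)) (fun x ih => ?_) x
  by_cases hx : Ur x
  · exact ⟨emp M, isOrd_emp, mem_V.2 (Or.inl (mem_ker.2 (Or.inl ⟨rfl, hx⟩)))⟩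
  · refine exists_mem_V hx fun y hy => ?_
    obtain ⟨α, hα, h⟩ := ih y hy
    exact ⟨α, hα, V_mono_left (fun u hu => mem_ker.2 (Or.inr ⟨y, hy, hu⟩)) α y h⟩

end Hierarchy

/-! ### Automorphisms induced by involutions of the urelements -/

section Automorphisms

variable {M : Type u} [lang.Structure M]

theorem mem_aut_iff (π : M ≃[lang] M) {x y : M} : Mem (π x) (π y) ↔ Mem x y := by
  have := Language.StrongHomClass.map_rel π (Rel.mem : lang.Relations 2) ![x, y]
  rw [Mem, Mem, ← this]
  refine iff_of_eq (congrArg _ (funext fun i => ?_))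
  fin_cases i <;> rfl

theorem ur_aut_iff (π : M ≃[lang] M) {x : M} : Ur (π x) ↔ Ur x := by
  have := Language.StrongHomClass.map_rel π (Rel.ur : lang.Relations 1) ![x]
  rw [Ur, Ur, ← this]
  refine iff_of_eq (congrArg _ (funext fun i => ?_))
  fin_cases i; rfl

/-- An involution that respects membership and urelements, as an automorphism. -/
def autOfInvolutive (f : M → M) (hf : Function.Involutive f) (h1 : ∀ x y, Mem (f x) (f y) ↔ Mem x y)
    (h2 : ∀ x, Ur (f x) ↔ Ur x) : M ≃[lang] M where
  toEquiv := hf.toPerm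
  map_fun' := fun f => f.elim
  map_rel' := by
    intro n r x
    cases r
    · have h3 : x = ![x 0, x 1] := by ext i; fin_cases i <;> rfl
      rw [h3]
      refine Iff.trans (iff_of_eq (congrArg _ (funext fun i => ?_))) (h1 (x 0) (x 1))
      fin_cases i <;> rfl
    · have h3 : x = ![x 0] := by ext i; fin_cases i; rfl
      rw [h3]
      refine Iff.trans (iff_of_eq (congrArg _ (funext fun i => ?_))) (h2 (x 0))
      fin_cases i; rfl

variable [hM : Fact (ModelsZFUR M)]

/-- The action on `M` of a map of the urelements. -/
noncomputable def act (σ : M → M) (x : M) : M :=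
  recF (fun x i => the (fun y => (Ur x ∧ y = σ x) ∨ (IsSet x ∧ y = i))) x

instance DF.act (σ : M → M) [hσ : DF σ] : DF (act σ) := by
  have h1 : DF (fun p : (M × M) × M => σ p.1.1) := hσ.comp _
  exact DF.recF_closed (G := fun x i =>
    UrelementSetTheory.the (fun y => (Ur x ∧ y = σ x) ∨ (IsSet x ∧ y = i)))

instance DF.act_comp (σ : M → M) [hσ : DF σ] {E : Type u} [Ctx M E] (f : E → M) [hf : DF f] :
    DF (fun e => UrelementSetTheory.act σ (f e)) :=
  DF.fun_comp (inferInstanceAs (DF (UrelementSetTheory.act σ))) hf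

section

variable (σ : M → M) [hσ : DF σ]

theorem act_eq (x : M) :
    act σ x = the (fun y => (Ur x ∧ y = σ x) ∨ (IsSet x ∧ y = image (act σ) x)) := by
  have h1 : DF (fun p : (M × M) × M => σ p.1.1) := hσ.comp _
  exact recF_rec (fun x i => the (fun y => (Ur x ∧ y = σ x) ∨ (IsSet x ∧ y = i))) x

theorem act_ur {x : M} (hx : Ur x) : act σ x = σ x := by
  rw [act_eq]
  exact the_eq (Or.inl ⟨hx, rfl⟩) (by rintro y (h | h); exacts [h.2, absurd hx h.1])

theorem act_set {x : M} (hx : IsSet x) : act σ x = image (act σ) x := by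
  rw [act_eq]
  exact the_eq (Or.inr ⟨hx, rfl⟩) (by rintro y (h | h); exacts [absurd h.1 hx, h.2])

/-- A definable involution of the urelements extends to a definable automorphism. -/
theorem exists_aut (h1 : ∀ u, Ur u → Ur (σ u)) (h2 : ∀ u, Ur u → σ (σ u) = u) :
    ∃ π : M ≃[lang] M, DF (fun x => π x) ∧ ∀ u, Ur u → π u = σ u := by
  have hur : ∀ x, Ur (act σ x) ↔ Ur x := by
    intro x
    by_cases hx : Ur x
    · simp [act_ur σ hx, h1 x hx, hx]
    · simp only [hx, iff_false, act_set σ hx]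
      exact isSet_mk _
  have hinv : Function.Involutive (act σ) := by
    refine mem_induction (fun x => act σ (act σ x) = x) fun x ih => ?_
    by_cases hx : Ur x
    · rw [act_ur σ hx, act_ur σ (h1 x hx), h2 x hx]
    · have hx' : IsSet (act σ x) := fun h => hx ((hur x).1 h)
      refine set_ext (fun h => hx' ((hur _).1 h)) hx fun z => ?_
      rw [act_set σ hx', mem_image, act_set σ hx]
      constructor
      · rintro ⟨w, hw, rfl⟩
        obtain ⟨y, hy, rfl⟩ := mem_image.1 hw
        rwa [ih y hy]
      · intro hz
        exact ⟨_, mem_image.2 ⟨z, hz, rfl⟩, (ih z hz).symm⟩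
  have hmem : ∀ x y, Mem x y → Mem (act σ x) (act σ y) := by
    intro x y h
    rw [act_set σ (isSet_of_mem h)]
    exact mem_image.2 ⟨x, h, rfl⟩
  refine ⟨autOfInvolutive (act σ) hinv (fun x y => ⟨fun h => ?_, hmem x y⟩) hur,
    DF.act σ, fun u hu => act_ur σ hu⟩
  have := hmem _ _ h
  rwa [hinv x, hinv y] at this

end

theorem aut_eq_self_of_mem_V (π : M ≃[lang] M) [hπ : DF (fun x => π x)] {A α : M}
    (hA : ∀ a, Mem a A → Ur a) (hα : IsOrd α) (h : ∀ a, Mem a A → π a = a) {x : M}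
    (hx : Mem x (V A α)) : π x = x := by
  have hT := isTransitiveSet_V hA hα
  refine mem_induction (fun x => Mem x (V A α) → π x = x) (fun x ih hx => ?_) x hx
  by_cases hu : Ur x
  · exact h x (mem_of_ur_mem_V hu hx)
  · refine set_ext (fun h => hu ((ur_aut_iff π).1 h)) hu fun z => ?_
    obtain ⟨y, rfl⟩ := π.surjective z
    rw [mem_aut_iff]
    constructor
    · intro hy; rwa [ih y hy (hT.mem_trans hy hx)]
    · intro hy
      have := ih (π y) hy (hT.mem_trans hy hx)
      rwa [π.injective this] at hy

/-- The level α is kept, not replaced by π α, since the induction on α pushes π through the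
construction stage by stage. -/
theorem aut_mem_V (π : M ≃[lang] M) [hπ : DF (fun x => π x)] {A A' α x : M}
    (h : ∀ a, Mem a A → Mem (π a) A') (hx : Mem x (V A α)) : Mem (π x) (V A' α) := by
  refine mem_induction (fun α => ∀ x, Mem x (V A α) → Mem (π x) (V A' α))
    (fun α ih x hx => ?_) α x hx
  rcases mem_V.1 hx with hx | ⟨β, hβ, hx, hx'⟩
  · exact mem_V.2 (Or.inl (h x hx))
  · refine mem_V.2 (Or.inr ⟨β, hβ, fun h => hx ((ur_aut_iff π).1 h), fun z hz => ?_⟩)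
    obtain ⟨y, rfl⟩ := π.surjective z
    exact ih β hβ y (hx' y ((mem_aut_iff π).1 hz))

end Automorphisms

/-! ### Injections into the urelements and their conjugacy -/

section Injections

variable {M : Type u} [lang.Structure M] [hM : Fact (ModelsZFUR M)] {E : Type u} [Ctx M E]

/-- The set of pairs `f` is injective on `α`, with values in the class `P`. -/
def InjTo (f α : M) (P : M → Prop) : Prop :=
  (∀ ξ, Mem ξ α → P (ap f ξ)) ∧ ∀ ξ η, Mem ξ α → Mem η α → ap f ξ = ap f η → ξ = η

instance Def.injTo (f α : E → M) (P : E → M → Prop) [DF f] [DF α]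
    [hP : Def M (fun p : E × M => P p.1 p.2)] : Def M (fun e => InjTo (f e) (α e) (P e)) := by
  unfold InjTo
  have : Def M (fun p : E × M => P p.1 (ap (f p.1) p.2)) :=
    Def.subst₂ (F := E) (P := P) hP (fun p : E × M => p.1) (fun p => ap (f p.1) p.2)
  infer_instance

/-- The class of the urelements that are not members of `A`. -/
def UrOff (A u : M) : Prop := Ur u ∧ ¬ Mem u A

instance Def.urOff (f g : E → M) [DF f] [DF g] : Def M (fun e => UrOff (f e) (g e)) := by
  unfold UrOff; infer_instance

instance Def.isSetOfUr (f : E → M) [DF f] : Def M (fun e => IsSetOfUr (f e)) := by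
  unfold IsSetOfUr; infer_instance

/-- There is an injection of `α` into the urelements outside of `A`. -/
def Avail (A α : M) : Prop := ∃ f, InjTo f α (UrOff A)

instance Def.avail (f g : E → M) [DF f] [DF g] : Def M (fun e => Avail (f e) (g e)) := by
  unfold Avail
  have : Def M (fun p : (E × M) × M => UrOff (f p.1.1) p.2) := inferInstance
  exact Def.ex (fun e x => InjTo x (g e) (UrOff (f e)))
    (hQ := Def.injTo (fun p : E × M => p.2) (fun p => g p.1) (fun p => UrOff (f p.1)))

instance Def.avail_self (A : M) : Def M (Avail A) := Def.avail (fun _ => A) (fun x => x)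

theorem InjTo.mono {f α β : M} {P Q : M → Prop} (h : InjTo f α P) (hβ : Sub β α)
    (hPQ : ∀ x, P x → Q x) : InjTo f β Q :=
  ⟨fun ξ hξ => hPQ _ (h.1 ξ (hβ ξ hξ)), fun ξ η hξ hη => h.2 ξ η (hβ ξ hξ) (hβ η hη)⟩

theorem injTo_graph (F : M → M) [DF F] {α : M} {P : M → Prop} (h : ∀ ξ, Mem ξ α → P (F ξ))
    (hF : ∀ ξ η, Mem ξ α → Mem η α → F ξ = F η → ξ = η) : InjTo (graph F α) α P := by
  refine ⟨fun ξ hξ => by rw [ap_graph F hξ]; exact h ξ hξ, fun ξ η hξ hη he => ?_⟩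
  rw [ap_graph F hξ, ap_graph F hη] at he
  exact hF ξ η hξ hη he

/-- The union of two sets. -/
noncomputable def cup (x y : M) : M := mkSet (fun z => Mem z x ∨ Mem z y)

instance DF.cup (f g : E → M) [DF f] [DF g] : DF (fun e => cup (f e) (g e)) := by
  unfold UrelementSetTheory.cup; infer_instance

@[simp] theorem mem_cup {x y z : M} : Mem z (cup x y) ↔ Mem z x ∨ Mem z y :=
  ((Small.mem x).or (Small.mem y)).mem_mk

theorem isSet_cup (x y : M) : IsSet (cup x y) := isSet_mk _

/-- Two injections with disjoint ranges are exchanged by an automorphism. -/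
theorem exists_aut_swap {f h α : M} (hf : InjTo f α Ur) (hh : InjTo h α Ur)
    (hfh : ∀ ξ η, Mem ξ α → Mem η α → ap f ξ ≠ ap h η) :
    ∃ π : M ≃[lang] M, DF (fun x => π x) ∧ (∀ ξ, Mem ξ α → π (ap f ξ) = ap h ξ) ∧
      ∀ u, Ur u → (∀ ξ, Mem ξ α → u ≠ ap f ξ ∧ u ≠ ap h ξ) → π u = u := by
  -- The graph of the involution exchanging f ξ with h ξ and fixing everything else; injectivity and
  -- disjointness of the ranges make it single-valued.
  let R : M → M → Prop := fun u v =>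
    (∃ ξ, Mem ξ α ∧ ((u = ap f ξ ∧ v = ap h ξ) ∨ (u = ap h ξ ∧ v = ap f ξ))) ∨
      ((∀ ξ, Mem ξ α → u ≠ ap f ξ ∧ u ≠ ap h ξ) ∧ v = u)
  let σ : M → M := fun u => the (R u)
  have dσ : DF σ := by dsimp only [σ, R]; infer_instance
  have hR : ∀ u v w, R u v → R u w → v = w := by
    rintro u v w (⟨ξ, hξ, h1⟩ | ⟨h1, h2⟩) (⟨η, hη, h3⟩ | ⟨h3, h4⟩)
    · have a1 := hf.2 ξ η hξ hη
      have a2 := hh.2 ξ η hξ hη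
      have a3 := hfh ξ η hξ hη
      have a4 := hfh η ξ hη hξ
      grind
    · have := h3 ξ hξ; grind
    · have := h1 η hη; grind
    · rw [h2, h4]
  have hσ : ∀ u v, R u v → σ u = v := fun u v h => the_eq h fun w hw => hR u w v hw h
  have key : ∀ u, (∃ ξ, Mem ξ α ∧ (u = ap f ξ ∨ u = ap h ξ)) ∨
      ∀ ξ, Mem ξ α → u ≠ ap f ξ ∧ u ≠ ap h ξ := by
    intro u
    by_cases h : ∃ ξ, Mem ξ α ∧ (u = ap f ξ ∨ u = ap h ξ)
    · exact Or.inl h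
    · exact Or.inr fun ξ hξ => ⟨fun h' => h ⟨ξ, hξ, Or.inl h'⟩, fun h' => h ⟨ξ, hξ, Or.inr h'⟩⟩
  have e1 : ∀ ξ, Mem ξ α → σ (ap f ξ) = ap h ξ := fun ξ hξ =>
    hσ _ _ (Or.inl ⟨ξ, hξ, Or.inl ⟨rfl, rfl⟩⟩)
  have e2 : ∀ ξ, Mem ξ α → σ (ap h ξ) = ap f ξ := fun ξ hξ =>
    hσ _ _ (Or.inl ⟨ξ, hξ, Or.inr ⟨rfl, rfl⟩⟩)
  have e3 : ∀ u, (∀ ξ, Mem ξ α → u ≠ ap f ξ ∧ u ≠ ap h ξ) → σ u = u := fun u hu =>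
    hσ _ _ (Or.inr ⟨hu, rfl⟩)
  obtain ⟨π, dπ, hπ⟩ := exists_aut σ
    (fun u hu => by
      rcases key u with ⟨ξ, hξ, rfl | rfl⟩ | h
      exacts [by rw [e1 ξ hξ]; exact hh.1 ξ hξ, by rw [e2 ξ hξ]; exact hf.1 ξ hξ,
        by rw [e3 u h]; exact hu])
    (fun u _ => by
      rcases key u with ⟨ξ, hξ, rfl | rfl⟩ | h
      exacts [(congrArg σ (e1 ξ hξ)).trans (e2 ξ hξ), (congrArg σ (e2 ξ hξ)).trans (e1 ξ hξ),
        (congrArg σ (e3 u h)).trans (e3 u h)])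
  exact ⟨π, dπ, fun ξ hξ => by rw [hπ _ (hf.1 ξ hξ), e1 ξ hξ],
    fun u hu h => by rw [hπ u hu, e3 u h]⟩

theorem DF.aut_comp (π π' : M ≃[lang] M) [hπ : DF (fun x => π x)] [hπ' : DF (fun x => π' x)] :
    DF (fun x => (π'.comp π) x) :=
  DF.fun_comp hπ' hπ

/-- Two injections of `α` into the urelements outside of `A` are conjugate by an automorphism that
fixes `A`, if there is room for a third one. -/
theorem exists_aut_conj {A f g α : M} (hA : IsSetOfUr A) (hf : InjTo f α (UrOff A))
    (hg : InjTo g α (UrOff A)) (h : ∀ A', IsSetOfUr A' → Sub A A' → Avail A' α) :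
    ∃ π : M ≃[lang] M, DF (fun x => π x) ∧ (∀ ξ, Mem ξ α → π (ap f ξ) = ap g ξ) ∧
      ∀ a, Mem a A → π a = a := by
  -- The ranges of f and g may overlap, so f is exchanged with an injection k avoiding both, and
  -- then k with g.
  obtain ⟨k, hk⟩ := h (cup A (cup (image (ap f) α) (image (ap g) α)))
    ⟨isSet_cup _ _, by
      intro y hy
      simp only [mem_cup, mem_image] at hy
      rcases hy with hy | ⟨ξ, hξ, rfl⟩ | ⟨ξ, hξ, rfl⟩
      exacts [hA.2 y hy, (hf.1 ξ hξ).1, (hg.1 ξ hξ).1]⟩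
    (fun z hz => mem_cup.2 (Or.inl hz))
  have hk' : ∀ ξ, Mem ξ α → ¬ Mem (ap k ξ) A ∧ (∀ η, Mem η α → ap k ξ ≠ ap f η) ∧
      ∀ η, Mem η α → ap k ξ ≠ ap g η := by
    intro ξ hξ
    have := (hk.1 ξ hξ).2
    simp only [mem_cup, mem_image, not_or, not_exists, not_and] at this
    exact this
  have kUr : InjTo k α Ur := hk.mono (Sub.refl _) fun _ h => h.1
  obtain ⟨π, dπ, h1, h2⟩ := exists_aut_swap (hf.mono (Sub.refl _) fun _ h => h.1) kUr
    fun ξ η hξ hη => ((hk' η hη).2.1 ξ hξ).symm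
  obtain ⟨π', dπ', h1', h2'⟩ := exists_aut_swap kUr (hg.mono (Sub.refl _) fun _ h => h.1)
    fun ξ η hξ hη => ((hk' ξ hξ).2.2 η hη)
  refine ⟨π'.comp π, DF.aut_comp π π', fun ξ hξ => ?_, fun a ha => ?_⟩
  · rw [Language.Equiv.comp_apply, h1 ξ hξ, h1' ξ hξ]
  · have a1 : ∀ ξ, Mem ξ α → a ≠ ap f ξ := fun ξ hξ h => (hf.1 ξ hξ).2 (h ▸ ha)
    have a2 : ∀ ξ, Mem ξ α → a ≠ ap g ξ := fun ξ hξ h => (hg.1 ξ hξ).2 (h ▸ ha)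
    have a3 : ∀ ξ, Mem ξ α → a ≠ ap k ξ := fun ξ hξ h => (hk' ξ hξ).1 (h ▸ ha)
    rw [Language.Equiv.comp_apply, h2 a (hA.2 a ha) fun ξ hξ => ⟨a1 ξ hξ, a3 ξ hξ⟩,
      h2' a (hA.2 a ha) fun ξ hξ => ⟨a3 ξ hξ, a2 ξ hξ⟩]

end Injections

/-! ### Enumerating well-orderable sets; stable sets of urelements -/

section Enumeration

variable {M : Type u} [lang.Structure M] [hM : Fact (ModelsZFUR M)]

instance Def.related (r : M) {E : Type u} [Ctx M E] (f g : E → M) [DF f] [DF g] :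
    Def M (fun e => Related r (f e) (g e)) := by
  unfold Related IsOrdPair IsPairSet; infer_instance

theorem WellOrderable.exists_choice {C : M} (h : WellOrderable C) : ∃ L : M → M, DF L ∧
    ∀ s, IsSet s → Sub s C → (∃ a, Mem a s) → Mem (L s) s := by
  obtain ⟨r, -, hirr, htr, -, hmin⟩ := h
  refine ⟨fun s => the (fun a => Mem a s ∧ ∀ b, Mem b s → b ≠ a → Related r a b), inferInstance,
    fun s hs hsC hne => ?_⟩
  obtain ⟨a, ha, h⟩ := hmin s hs hsC hne
  refine (the_spec (P := fun a => Mem a s ∧ ∀ b, Mem b s → b ≠ a → Related r a b)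
    ⟨a, ⟨ha, h⟩, ?_⟩).1
  rintro b ⟨hb, h'⟩
  by_contra hba
  exact hirr a (hsC a ha) (htr a b a (hsC a ha) (hsC b hb) (hsC a ha) (h b hb hba)
    (h' a ha (Ne.symm hba)))

/-- An injection of an ordinal extends to one whose range contains a given well-orderable set. -/
theorem exists_injTo_extend {f α C : M} {P : M → Prop} (hα : IsOrd α) (hf : InjTo f α P)
    (hC : WellOrderable C) (hCP : ∀ c, Mem c C → P c) :
    ∃ β g, IsOrd β ∧ Sub α β ∧ InjTo g β P ∧ (∀ ξ, Mem ξ α → ap g ξ = ap f ξ) ∧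
      (∀ c, Mem c C → ∃ ξ, Mem ξ β ∧ c = ap g ξ) ∧ ∀ ξ, Mem ξ β → Mem ξ α ∨ Mem (ap g ξ) C := by
  obtain ⟨L, dL, hL⟩ := hC.exists_choice
  -- Follow f below α; from then on choose the least element of C not yet listed.
  let G : M → M → M := fun ξ i => the (fun y => (Mem ξ α ∧ y = ap f ξ) ∨
    (¬ Mem ξ α ∧ y = L (mkSet (fun z => Mem z C ∧ ¬ Mem z i))))
  have dG : DF (fun p : M × M => G p.1 p.2) := by
    have : DF (fun p : (M × M) × M => L (mkSet (fun z => Mem z C ∧ ¬ Mem z p.1.2))) :=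
      DF.fun_comp dL inferInstance
    dsimp only [G]; infer_instance
  let F : M → M := recF G
  have dF : DF F := DF.recF_closed
  have dF' : DF (fun x => F x) := dF
  have hF : ∀ ξ, F ξ = the (fun y => (Mem ξ α ∧ y = ap f ξ) ∨
    (¬ Mem ξ α ∧ y = L (mkSet (fun z => Mem z C ∧ ¬ Mem z (image F ξ))))) := fun ξ => recF_rec G ξ
  have hF1 : ∀ ξ, Mem ξ α → F ξ = ap f ξ := fun ξ hξ => by
    rw [hF]; exact the_eq (Or.inl ⟨hξ, rfl⟩) (by rintro y (h | h); exacts [h.2, absurd hξ h.1])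
  have hF2 : ∀ ξ, ¬ Mem ξ α → ¬ Sub C (image F ξ) → Mem (F ξ) C ∧ ¬ Mem (F ξ) (image F ξ) := by
    intro ξ hξ hs
    have h1 : F ξ = L (mkSet (fun z => Mem z C ∧ ¬ Mem z (image F ξ))) := by
      rw [hF]; exact the_eq (Or.inr ⟨hξ, rfl⟩) (by rintro y (h | h); exacts [absurd h.1 hξ, h.2])
    have h2 : Small (fun z => Mem z C ∧ ¬ Mem z (image F ξ)) := Small.sep _ _
    rw [← h2.mem_mk, h1]
    refine hL _ (isSet_mk _) (fun z hz => (h2.mem_mk.1 hz).1) ?_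
    simp only [Sub, not_forall] at hs
    obtain ⟨z, hz, hz'⟩ := hs
    exact ⟨z, h2.mem_mk.2 ⟨hz, hz'⟩⟩
  -- If C were never exhausted, F would inject all ordinals outside α into C, and by Replacement
  -- along the inverse the ordinals would be contained in a set.
  have hfull : ∃ ξ, IsOrd ξ ∧ (¬ Mem ξ α ∧ Sub C (image F ξ)) := by
    by_contra! hne
    have d : DF (fun c : M => the (fun ξ => (IsOrd ξ ∧ ¬ Mem ξ α) ∧ F ξ = c)) := inferInstance
    refine not_forall_ord_mem (cup α (image
      (fun c => the (fun ξ => (IsOrd ξ ∧ ¬ Mem ξ α) ∧ F ξ = c)) C)) fun ξ hξ => ?_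
    rw [mem_cup, mem_image]
    by_cases hξα : Mem ξ α
    · exact Or.inl hξα
    · refine Or.inr ⟨F ξ, (hF2 ξ hξα (hne ξ hξ hξα)).1, Eq.symm
        (the_eq ⟨⟨hξ, hξα⟩, rfl⟩ ?_)⟩
      rintro η ⟨⟨hη, hηα⟩, he⟩
      rcases hη.trichotomy hξ with h | h | h
      · exact absurd (mem_image.2 ⟨η, h, he.symm⟩) (hF2 ξ hξα (hne ξ hξ hξα)).2
      · exact h
      · exact absurd (mem_image.2 ⟨ξ, h, he⟩) (hF2 η hηα (hne η hη hηα)).2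
  obtain ⟨β, hβ, ⟨hβα, hCβ⟩, hmin⟩ := exists_least (fun ξ => ¬ Mem ξ α ∧ Sub C (image F ξ)) hfull
  have hF3 : ∀ ξ, Mem ξ β → ¬ Mem ξ α → Mem (F ξ) C ∧ ¬ Mem (F ξ) (image F ξ) :=
    fun ξ hξ hξα => hF2 ξ hξα fun h => hmin ξ hξ ⟨hξα, h⟩
  have hlt : ∀ ξ η, Mem ξ η → Mem ξ β → Mem η β → F ξ ≠ F η := by
    intro ξ η hξη hξ hη he
    by_cases hηα : Mem η α
    · have hξα := hα.mem_trans hξη hηα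
      rw [hF1 ξ hξα, hF1 η hηα] at he
      have := hf.2 ξ η hξα hηα he
      subst this
      exact not_mem_self _ hξη
    · exact (hF3 η hη hηα).2 (mem_image.2 ⟨ξ, hξη, he.symm⟩)
  have hαβ : Sub α β := hβ.sub_of_not_mem hα hβα
  refine ⟨β, graph F β, hβ, hαβ, injTo_graph F (fun ξ hξ => ?_) (fun ξ η hξ hη he => ?_),
    fun ξ hξ => ?_, fun c hc => ?_, fun ξ hξ => ?_⟩
  · by_cases hξα : Mem ξ α
    · rw [hF1 ξ hξα]; exact hf.1 ξ hξα
    · exact hCP _ (hF3 ξ hξ hξα).1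
  · rcases (hβ.mem hξ).trichotomy (hβ.mem hη) with h | h | h
    exacts [absurd he (hlt ξ η h hξ hη), h, absurd he.symm (hlt η ξ h hη hξ)]
  · rw [ap_graph F (hαβ ξ hξ), hF1 ξ hξ]
  · obtain ⟨ξ, hξ, h⟩ := mem_image.1 (hCβ c hc)
    exact ⟨ξ, hξ, by rw [ap_graph F hξ, h]⟩
  · rw [ap_graph F hξ]
    by_cases hξα : Mem ξ α
    exacts [Or.inl hξα, Or.inr (hF3 ξ hξ hξα).1]

/-- A set of urelements can be enlarged until removing more urelements no longer matters for which
ordinals inject into what remains. -/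
theorem exists_avail_stable {A₀ : M} (hA₀ : IsSetOfUr A₀) : ∃ A, IsSetOfUr A ∧ Sub A₀ A ∧
    ∀ A', IsSetOfUr A' → Sub A A' → ∀ α, IsOrd α → Avail A α → Avail A' α := by
  by_cases h : ∃ α, IsOrd α ∧ ∃ A, (IsSetOfUr A ∧ Sub A₀ A) ∧ ¬ Avail A α
  -- α is the least ordinal that some enlargement of A₀ makes unavailable, and A is such an
  -- enlargement. Ordinals available off A lie below α, so by minimality no enlargement destroys
  -- them.
  · obtain ⟨α, hα, ⟨A, ⟨hA, hsub⟩, hav⟩, hmin⟩ := exists_least _ h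
    refine ⟨A, hA, hsub, fun A' hA' hs β hβ hβA => ?_⟩
    by_contra hn
    refine hmin β ?_ ⟨A', ⟨hA', hsub.trans hs⟩, hn⟩
    by_contra hβα
    obtain ⟨f, hf⟩ := hβA
    exact hav ⟨f, hf.mono (hβ.sub_of_not_mem hα hβα) fun _ h => h⟩
  · push Not at h
    exact ⟨A₀, hA₀, Sub.refl _, fun A' hA' hs α hα _ => h α hα A' ⟨hA', hs⟩⟩

end Enumeration

/-! ### Formulas with a distinguished last variable -/

section Formulas

variable {M : Type u} [lang.Structure M]

theorem Def.realize_elim {ι : Type} [Finite ι] (ψ : lang.Formula (ι ⊕ Fin 1)) :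
    Def M (fun p : (ι → M) × M => ψ.Realize (Sum.elim p.1 fun _ => p.2)) := by
  have : IsProj M (fun p : (ι → M) × M => (Sum.elim p.1 (fun _ => p.2) : ι ⊕ Fin 1 → M)) := by
    refine ⟨?_⟩
    rintro t (⟨i | i, rfl⟩ | ⟨c, rfl⟩)
    · exact Or.inl ⟨_, Or.inl ⟨i, rfl⟩, rfl⟩
    · exact Or.inr ⟨id, Or.inl rfl, rfl⟩
    · exact Ctx.const_mem c
  exact (Def.realize ψ).comp (fun p : (ι → M) × M => (Sum.elim p.1 (fun _ => p.2) : ι ⊕ Fin 1 → M))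

/-- The negation appears because the reflection argument for ∀ looks for counterexamples. -/
theorem exists_formula_of_bounded {n k : ℕ} (θ : lang.BoundedFormula (Fin n) (k + 1)) :
    ∃ ψ : lang.Formula ((Fin n ⊕ Fin k) ⊕ Fin 1), ∀ (v : Fin n → M) (xs : Fin k → M) (y : M),
      ψ.Realize (Sum.elim (Sum.elim v xs) fun _ => y) ↔ ¬ θ.Realize v (Fin.snoc xs y) := by
  let r : Fin n ⊕ Fin (k + 1) → (Fin n ⊕ Fin k) ⊕ Fin 1 := Sum.elim (fun i => Sum.inl (Sum.inl i))
    (Fin.lastCases (Sum.inr 0) fun j => Sum.inl (Sum.inr j))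
  refine ⟨(θ.toFormula.relabel r).not, fun v xs y => ?_⟩
  rw [Language.Formula.realize_not, Language.Formula.realize_relabel,
    Language.BoundedFormula.realize_toFormula]
  refine not_congr (iff_of_eq ?_)
  congr 1
  funext j
  refine Fin.lastCases ?_ (fun j => ?_) j
  · simp [r]
  · simp [r]

end Formulas

/-! ### Lévy reflection along a coded hierarchy -/

section Hierarchies

variable {M : Type u} [lang.Structure M] [hM : Fact (ModelsZFUR M)]

/-- A family of hierarchies `S b` of transitive sets, with `b` ranging over codes that may describe
only the levels `β` for which `OK b β` holds. -/
structure IsHierarchy (OK : M → M → Prop) (S : M → M → M) : Prop where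
  def_ok : Def M (fun p : M × M => OK p.1 p.2)
  def_level : DF (fun p : M × M => S p.1 p.2)
  exists_code : ∀ α, IsOrd α → ∃ b, OK b α
  ok_of_mem : ∀ b α β, IsOrd α → OK b α → Mem β α → OK b β
  transitive : ∀ b α, IsOrd α → OK b α → IsTransitiveSet (S b α)
  mono : ∀ b α β, IsOrd α → OK b α → Mem β α → Sub (S b β) (S b α)
  witness : ∀ (ι : Type) [Finite ι] (ψ : lang.Formula (ι ⊕ Fin 1)) (α : M), IsOrd α →
    ∃ β, IsOrd β ∧ ∀ b, OK b α → OK b β → ∀ v : ι → M, (∀ i, Mem (v i) (S b α)) →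
      (∃ y, ψ.Realize (Sum.elim v fun _ => y)) →
      ∃ y, Mem y (S b β) ∧ ψ.Realize (Sum.elim v fun _ => y)

namespace IsHierarchy

variable {OK : M → M → Prop} {S : M → M → M}

theorem exists_level_of_finite (hS : IsHierarchy OK S) {κ b t α₀ : M} (hκ : IsOrd κ)
    (hα₀ : Mem α₀ κ) (hlim : ∀ α, Mem α κ → ∃ β, Mem β κ ∧ Mem α β)
    (hb : ∀ β, Mem β κ → OK b β) (ht : ∀ z, Mem z t ↔ ∃ β, Mem β κ ∧ Mem z (S b β)) :
    ∀ {m : ℕ} (v : Fin m → M), (∀ i, Mem (v i) t) → ∃ β, Mem β κ ∧ ∀ i, Mem (v i) (S b β)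
  | 0, _, _ => ⟨α₀, hα₀, fun i => i.elim0⟩
  | m + 1, v, hv => by
    obtain ⟨β, hβ, h⟩ := exists_level_of_finite hS hκ hα₀ hlim hb ht (fun i => v (Fin.castSucc i))
      fun i => hv _
    obtain ⟨γ, hγ, h'⟩ := (ht _).1 (hv (Fin.last m))
    rcases (hκ.mem hβ).trichotomy (hκ.mem hγ) with hlt | rfl | hlt
    · exact ⟨γ, hγ, Fin.lastCases h' fun i => hS.mono b γ β (hκ.mem hγ) (hb γ hγ) hlt _ (h i)⟩
    · exact ⟨β, hβ, Fin.lastCases h' h⟩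
    · exact ⟨β, hβ, Fin.lastCases (hS.mono b β γ (hκ.mem hβ) (hb β hβ) hlt _ h') h⟩

/-- If `κ` is closed under a suitable relation `W`, then the union of the levels below `κ`
reflects the formula `φ`. -/
theorem exists_modulus (hS : IsHierarchy OK S) {n k : ℕ} (φ : lang.BoundedFormula (Fin n) k) :
    ∃ W : M → M → Prop, Def M (fun p : M × M => W p.1 p.2) ∧
      (∀ α β γ, IsOrd γ → Mem β γ → W α β → W α γ) ∧ (∀ α, IsOrd α → ∃ β, IsOrd β ∧ W α β) ∧
      ∀ κ b t α₀, IsOrd κ → Mem α₀ κ → (∀ α, Mem α κ → ∃ β, Mem β κ ∧ Mem α β ∧ W α β) →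
        (∀ β, Mem β κ → OK b β) → (∀ z, Mem z t ↔ ∃ β, Mem β κ ∧ Mem z (S b β)) →
        ∀ (v : Fin n → M) (xs : Fin k → M), (∀ i, Mem (v i) t) → (∀ i, Mem (xs i) t) →
          (φ.Realize v xs ↔ RealizeIn t φ v xs) := by
  induction φ with
  | falsum => exact ⟨fun _ _ => True, inferInstance, fun _ _ _ _ _ h => h,
      fun α hα => ⟨α, hα, trivial⟩, fun _ _ _ _ _ _ _ _ _ _ _ _ _ => Iff.rfl⟩
  | equal => exact ⟨fun _ _ => True, inferInstance, fun _ _ _ _ _ h => h,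
      fun α hα => ⟨α, hα, trivial⟩, fun _ _ _ _ _ _ _ _ _ _ _ _ _ => Iff.rfl⟩
  | rel => exact ⟨fun _ _ => True, inferInstance, fun _ _ _ _ _ h => h,
      fun α hα => ⟨α, hα, trivial⟩, fun _ _ _ _ _ _ _ _ _ _ _ _ _ => Iff.rfl⟩
  | imp φ ψ ihφ ihψ =>
    obtain ⟨W, dW, hW1, hW2, hW3⟩ := ihφ
    obtain ⟨W', dW', hW1', hW2', hW3'⟩ := ihψ
    refine ⟨fun α β => W α β ∧ W' α β, inferInstance, fun α β γ hγ hβ h =>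
      ⟨hW1 α β γ hγ hβ h.1, hW1' α β γ hγ hβ h.2⟩, fun α hα => ?_, ?_⟩
    · obtain ⟨β, hβ, h⟩ := hW2 α hα
      obtain ⟨β', hβ', h'⟩ := hW2' α hα
      obtain ⟨γ, hγ, h1, h2⟩ := exists_ord_mem₂ hβ hβ'
      exact ⟨γ, hγ, hW1 α β γ hγ h1 h, hW1' α β' γ hγ h2 h'⟩
    · intro κ b t α₀ hκ hα₀ hcl hb ht v xs hv hxs
      have h1 := hW3 κ b t α₀ hκ hα₀ (fun α hα => by
        obtain ⟨β, hβ, h, h'⟩ := hcl α hα; exact ⟨β, hβ, h, h'.1⟩) hb ht v xs hv hxs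
      have h2 := hW3' κ b t α₀ hκ hα₀ (fun α hα => by
        obtain ⟨β, hβ, h, h'⟩ := hcl α hα; exact ⟨β, hβ, h, h'.2⟩) hb ht v xs hv hxs
      exact imp_congr h1 h2
  | @all k θ ih =>
    obtain ⟨W, dW, hW1, hW2, hW3⟩ := ih
    obtain ⟨ψ, hψ⟩ := exists_formula_of_bounded (M := M) θ
    -- Quantifying over all codes keeps the modulus independent of b, so that κ can be found before
    -- a code for it is fixed.
    let W' : M → M → Prop := fun α β => ∀ b, OK b α → OK b β → ∀ v : Fin n ⊕ Fin k → M,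
      (∀ i, Mem (v i) (S b α)) → (∃ y, ψ.Realize (Sum.elim v fun _ => y)) →
      ∃ y, Mem y (S b β) ∧ ψ.Realize (Sum.elim v fun _ => y)
    have dW' : Def M (fun p : M × M => W' p.1 p.2) := by
      have d1 : Def M (fun p : (M × M) × M => OK p.2 p.1.1) :=
        Def.comp_pair (F := M) (P := OK) hS.def_ok _ _
      have d2 : Def M (fun p : (M × M) × M => OK p.2 p.1.2) :=
        Def.comp_pair (F := M) (P := OK) hS.def_ok _ _
      have d3 : DF (fun p : ((M × M) × M) × (Fin n ⊕ Fin k → M) => S p.1.2 p.1.1.1) :=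
        DF.comp_pair (F := M) (f := S) hS.def_level _ _
      have d4 : DF (fun p : (((M × M) × M) × (Fin n ⊕ Fin k → M)) × M => S p.1.1.2 p.1.1.1.2) :=
        DF.comp_pair (F := M) (f := S) hS.def_level _ _
      have d5 : Def M (fun p : (((M × M) × M) × (Fin n ⊕ Fin k → M)) × M =>
          ψ.Realize (Sum.elim p.1.2 fun _ => p.2)) :=
        Def.comp_pair (F := Fin n ⊕ Fin k → M) (P := fun v y => ψ.Realize (Sum.elim v fun _ => y))
          (Def.realize_elim ψ) _ _
      dsimp only [W']
      infer_instance
    have hmono : ∀ α β γ, IsOrd γ → Mem β γ → W' α β → W' α γ := by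
      intro α β γ hγ hβ h b hbα hbγ v hv hy
      obtain ⟨y, hy, hy'⟩ := h b hbα (hS.ok_of_mem b γ β hγ hbγ hβ) v hv hy
      exact ⟨y, hS.mono b γ β hγ hbγ hβ y hy, hy'⟩
    refine ⟨fun α β => W α β ∧ W' α β, inferInstance, fun α β γ hγ hβ h =>
      ⟨hW1 α β γ hγ hβ h.1, hmono α β γ hγ hβ h.2⟩, fun α hα => ?_, ?_⟩
    · obtain ⟨β, hβ, h⟩ := hW2 α hα
      obtain ⟨β', hβ', h'⟩ := hS.witness _ ψ α hα
      obtain ⟨γ, hγ, h1, h2⟩ := exists_ord_mem₂ hβ hβ'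
      exact ⟨γ, hγ, hW1 α β γ hγ h1 h, hmono α β' γ hγ h2 h'⟩
    · intro κ b t α₀ hκ hα₀ hcl hb ht v xs hv hxs
      have h1 := hW3 κ b t α₀ hκ hα₀ (fun α hα => by
        obtain ⟨β, hβ, h, h'⟩ := hcl α hα; exact ⟨β, hβ, h, h'.1⟩) hb ht
      have hsnoc : ∀ y, Mem y t → ∀ i, Mem ((Fin.snoc xs y : Fin (k + 1) → M) i) t := by
        intro y hy
        refine Fin.lastCases ?_ fun i => ?_
        · simpa using hy
        · simpa using hxs i
      rw [Language.BoundedFormula.realize_all]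
      change _ ↔ ∀ a, Mem a t → RealizeIn t θ v (Fin.snoc xs a)
      constructor
      · intro h a ha
        exact (h1 v (Fin.snoc xs a) hv (hsnoc a ha)).1 (h a)
      · intro h a
        -- Tarski–Vaught: the parameters already lie at one level α below κ, so a counterexample in
        -- the universe yields one at a level β below κ, hence in t.
        by_contra ha
        obtain ⟨α, hα, hvα⟩ := hS.exists_level_of_finite hκ hα₀ (fun α hα => by
          obtain ⟨β, hβ, h, -⟩ := hcl α hα; exact ⟨β, hβ, h⟩) hb ht
          (Fin.append v xs) (Fin.addCases (by simpa using hv) (by simpa using hxs))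
        have hvα1 : ∀ i, Mem (v i) (S b α) := fun i => by simpa using hvα (Fin.castAdd k i)
        have hvα2 : ∀ i, Mem (xs i) (S b α) := fun i => by simpa using hvα (Fin.natAdd n i)
        obtain ⟨β, hβ, -, -, hw⟩ := hcl α hα
        obtain ⟨y, hy, hy'⟩ := hw b (hb α hα) (hb β hβ) (Sum.elim v xs)
          (by rintro (i | i); exacts [hvα1 i, hvα2 i]) ⟨a, (hψ v xs a).2 ha⟩
        have hyt : Mem y t := (ht y).2 ⟨β, hβ, hy⟩
        exact (hψ v xs y).1 hy' ((h1 v (Fin.snoc xs y) hv (hsnoc y hyt)).2 (h y hyt))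

/-- First find κ closed under the modulus, then pick a single code b for κ; it also codes every
level below κ. No coherent choice of codes along the ordinals is needed. -/
theorem exists_reflecting (hS : IsHierarchy OK S) {x α₀ : M} (hα₀ : IsOrd α₀)
    (hx : ∀ b, OK b α₀ → Sub x (S b α₀)) {n : ℕ} (φ : lang.Formula (Fin n)) :
    ∃ t : M, IsTransitiveSet t ∧ Sub x t ∧
      ∀ v : Fin n → M, (∀ i, Mem (v i) t) → (φ.Realize v ↔ RealizeIn t φ v default) := by
  obtain ⟨W, dW, hW1, hW2, hW3⟩ := hS.exists_modulus φ
  obtain ⟨κ, hκ, hα₀κ, hcl⟩ := exists_closed_ord (fun α β => Mem α β ∧ W α β) (fun α hα => by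
    obtain ⟨β, hβ, h⟩ := hW2 α hα
    obtain ⟨γ, hγ, h1, h2⟩ := exists_ord_mem₂ hα hβ
    exact ⟨γ, hγ, h1, hW1 α β γ hγ h2 h⟩) hα₀
  obtain ⟨b, hb⟩ := hS.exists_code κ hκ
  have hbβ : ∀ β, Mem β κ → OK b β := fun β hβ => hS.ok_of_mem b κ β hκ hb hβ
  have dS : DF (fun β => S b β) := DF.comp_pair (F := M) (f := S) hS.def_level (fun _ => b) _
  obtain ⟨t, hts, ht⟩ := Small.iUnion (fun β => S b β) κ
  refine ⟨t, ⟨hts, fun y hy z hz => ?_⟩, fun z hz => (ht z).2 ⟨α₀, hα₀κ, hx b (hbβ α₀ hα₀κ) z hz⟩,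
    fun v hv => hW3 κ b t α₀ hκ hα₀κ hcl hbβ ht v default hv fun i => i.elim0⟩
  obtain ⟨β, hβ, hy⟩ := (ht y).1 hy
  exact (ht z).2 ⟨β, hβ, (hS.transitive b β (hκ.mem hβ) (hbβ β hβ)).mem_trans hz hy⟩

end IsHierarchy

/-- A definable increasing sequence of transitive sets whose union is an elementary submodel. -/
theorem isHierarchy_of_elementary (S : M → M) [dS : DF S]
    (hT : ∀ α, IsOrd α → IsTransitiveSet (S α))
    (hmono : ∀ α β, IsOrd α → Mem β α → Sub (S β) (S α))
    (hw : ∀ (ι : Type) [Finite ι] (ψ : lang.Formula (ι ⊕ Fin 1)) (α : M), IsOrd α →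
      ∀ v : ι → M, (∀ i, Mem (v i) (S α)) → (∃ y, ψ.Realize (Sum.elim v fun _ => y)) →
      ∃ β, IsOrd β ∧ ∃ y, Mem y (S β) ∧ ψ.Realize (Sum.elim v fun _ => y)) :
    IsHierarchy (fun _ _ : M => True) (fun _ α => S α) where
  def_ok := inferInstance
  def_level := dS.comp _
  exists_code _ _ := ⟨emp M, trivial⟩
  ok_of_mem _ _ _ _ _ _ := trivial
  transitive _ α hα _ := hT α hα
  mono _ α β hα _ h := hmono α β hα h
  witness ι _ ψ α hα := by
    have d1 : Def M (fun p : ((ι → M) × M) × M => ψ.Realize (Sum.elim p.1.1 fun _ => p.2)) :=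
      Def.comp_pair (F := ι → M) (P := fun v y => ψ.Realize (Sum.elim v fun _ => y))
        (Def.realize_elim ψ) _ _
    have d2 : Def M (fun p : (ι → M) × M => ψ.Realize (Sum.elim p.1 fun _ => p.2)) :=
      Def.realize_elim ψ
    -- Each parameter tuple has its own witness level; least levels and Replacement give one bound
    -- for all tuples from S α.
    obtain ⟨β, hβ, h⟩ := exists_ord_bound_pi (S α)
      (fun (v : ι → M) γ => (∃ y, ψ.Realize (Sum.elim v fun _ => y)) →
        ∃ y, Mem y (S γ) ∧ ψ.Realize (Sum.elim v fun _ => y)) (fun v hv => by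
        by_cases hy : ∃ y, ψ.Realize (Sum.elim v fun _ => y)
        · obtain ⟨β, hβ, h⟩ := hw ι ψ α hα v hv hy
          exact ⟨β, hβ, fun _ => h⟩
        · exact ⟨α, hα, fun h => absurd h hy⟩)
    refine ⟨β, hβ, fun _ _ _ v hv hy => ?_⟩
    obtain ⟨γ, hγ, h'⟩ := h v hv
    obtain ⟨y, hy, hy'⟩ := h' hy
    exact ⟨y, hmono β γ hβ hγ y hy, hy'⟩

theorem exists_sub_V {A : M} (hA : ∀ u : M, Ur u → Mem u A) (x : M) :
    ∃ α, IsOrd α ∧ Mem x (V A α) := by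
  obtain ⟨α, hα, h⟩ := exists_mem_V_ker x
  exact ⟨α, hα, V_mono_left (fun u hu => hA u ((isSetOfUr_ker x).2 u hu)) α x h⟩

/-- If the urelements form a set, then Reflection holds. -/
theorem reflection_of_urelementsFormSet (h : UrelementsFormSet M) : ReflectionPrinciple M := by
  obtain ⟨A, hA, hAu⟩ := h
  have hA' : ∀ a, Mem a A → Ur a := fun a => (hAu a).1
  intro n φ x hx
  obtain ⟨α, hα, hxα⟩ := exists_sub_V (fun u => (hAu u).2) x
  have hS := isHierarchy_of_elementary (V A) (fun α hα => isTransitiveSet_V hA' hα)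
    (fun α β hα hβ => hα.V_mono A hβ) (fun ι _ ψ α hα v hv hy => by
      obtain ⟨y, hy⟩ := hy
      obtain ⟨β, hβ, h⟩ := exists_sub_V (fun u => (hAu u).2) y
      exact ⟨β, hβ, y, h, hy⟩)
  exact hS.exists_reflecting hα (fun _ _ => (isTransitiveSet_V hA' hα).2 x hxα) φ

end Hierarchies

/-! ### Reflection implies Collection -/

section Relativization

variable {M : Type u} [lang.Structure M]

/-- The members of `t`, as a substructure. -/
abbrev Members (t : M) : Type u := {a : M // Mem a t}

instance (t : M) : lang.Structure (Members t) where
  funMap f := f.elim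
  RelMap r x := Language.Structure.RelMap r (fun i => (x i).1)

theorem term_realize_members {t : M} {γ : Type} (v : γ → Members t) (s : lang.Term γ) :
    s.realize (fun i => (v i).1) = (s.realize v).1 := by
  cases s with
  | var => rfl
  | func f => exact f.elim

/-- Relativization to `t` is truth in the structure of the members of `t`. -/
theorem realizeIn_iff {t : M} {α : Type} {n : ℕ} (φ : lang.BoundedFormula α n) (v : α → Members t)
    (xs : Fin n → Members t) :
    RealizeIn t φ (fun i => (v i).1) (fun i => (xs i).1) ↔ φ.Realize v xs := by
  have hel : ∀ {n : ℕ} (xs : Fin n → Members t),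
      Sum.elim (fun i => (v i).1) (fun i => (xs i).1) = fun i => (Sum.elim v xs i).1 := by
    intro n xs; funext i; cases i <;> rfl
  induction φ with
  | falsum => rfl
  | equal s₁ s₂ =>
    simp only [RealizeIn, Language.BoundedFormula.Realize, hel, term_realize_members]
    exact Subtype.ext_iff.symm
  | rel R ts =>
    simp only [RealizeIn, Language.BoundedFormula.Realize, hel, term_realize_members]
    rfl
  | imp φ ψ ihφ ihψ => exact imp_congr (ihφ xs) (ihψ xs)
  | all φ ih =>
    have hs : ∀ a : Members t, (fun i => ((Fin.snoc xs a : Fin (_ + 1) → Members t) i).1) =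
        (Fin.snoc (fun i => (xs i).1) a.1 : Fin (_ + 1) → M) := by
      intro a; funext i
      refine Fin.lastCases ?_ (fun i => ?_) i <;> simp
    rw [Language.BoundedFormula.realize_all]
    constructor
    · intro h a
      refine (ih (Fin.snoc xs a)).1 ?_
      rw [hs]
      exact h a.1 a.2
    · intro h a ha
      have := (ih (Fin.snoc xs ⟨a, ha⟩)).2 (h ⟨a, ha⟩)
      rwa [hs] at this

/-- `∃ y, φ(x, y, p)`, with further free variables. -/
noncomputable def exSecond {n : ℕ} (φ : lang.Formula (Fin (n + 2))) :
    lang.Formula (Fin 4 ⊕ Fin n) :=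
  Language.Formula.iExs (Fin 1) (φ.relabel
    (Matrix.vecCons (Sum.inl (Sum.inl 2)) (Matrix.vecCons (Sum.inr 0) fun i => Sum.inl (Sum.inr i))))

/-- A formula that amounts to `φ` if the first two variables agree, and to `∃ y, φ` otherwise. -/
noncomputable def caseFormula {n : ℕ} (φ : lang.Formula (Fin (n + 2))) :
    lang.Formula (Fin 4 ⊕ Fin n) :=
  let e := Language.Term.equal (L := lang) (Language.Term.var (Sum.inl (0 : Fin 4) : Fin 4 ⊕ Fin n))
    (Language.Term.var (Sum.inl 1))
  (e.imp (φ.relabel (Matrix.vecCons (Sum.inl 2) (Matrix.vecCons (Sum.inl 3) Sum.inr)))) ⊓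
    (e.not.imp (exSecond φ))

theorem realize_exSecond {n : ℕ} (φ : lang.Formula (Fin (n + 2))) (a : Fin 4 → M) (p : Fin n → M) :
    (exSecond φ).Realize (Sum.elim a p) ↔
      ∃ y, φ.Realize (Matrix.vecCons (a 2) (Matrix.vecCons y p)) := by
  rw [exSecond, Language.Formula.realize_iExs]
  have : ∀ y : Fin 1 → M, (Sum.elim (Sum.elim a p) y) ∘ (Matrix.vecCons (Sum.inl (Sum.inl 2))
      (Matrix.vecCons (Sum.inr 0) fun i => Sum.inl (Sum.inr i))) =
      Matrix.vecCons (a 2) (Matrix.vecCons (y 0) p) := by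
    intro y; funext i
    refine Fin.cases ?_ (fun i => Fin.cases ?_ (fun i => ?_) i) i <;> simp
  simp only [Language.Formula.realize_relabel, this]
  exact ⟨fun ⟨y, h⟩ => ⟨y 0, h⟩, fun ⟨y, h⟩ => ⟨fun _ => y, h⟩⟩

theorem realize_caseFormula {n : ℕ} (φ : lang.Formula (Fin (n + 2))) (a : Fin 4 → M)
    (p : Fin n → M) : (caseFormula φ).Realize (Sum.elim a p) ↔
      (a 0 = a 1 → φ.Realize (Matrix.vecCons (a 2) (Matrix.vecCons (a 3) p))) ∧
      (a 0 ≠ a 1 → ∃ y, φ.Realize (Matrix.vecCons (a 2) (Matrix.vecCons y p))) := by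
  have : (Sum.elim a p) ∘ (Matrix.vecCons (Sum.inl 2) (Matrix.vecCons (Sum.inl 3) Sum.inr)) =
      Matrix.vecCons (a 2) (Matrix.vecCons (a 3) p) := by
    funext i
    refine Fin.cases ?_ (fun i => Fin.cases ?_ (fun i => ?_) i) i <;> simp
  simp only [caseFormula, Language.Formula.realize_inf, Language.Formula.realize_imp,
    Language.Formula.realize_not, Language.Formula.realize_equal, Language.Formula.realize_relabel,
    realize_exSecond, this, Language.Term.realize_var, Sum.elim_inl, ne_eq]

variable [hM : Fact (ModelsZFUR M)]

theorem exists_set_of_fin : ∀ {m : ℕ} (v : Fin m → M), ∃ s : M, IsSet s ∧ ∀ i, Mem (v i) s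
  | 0, _ => ⟨emp M, isSet_emp, fun i => i.elim0⟩
  | m + 1, v => by
    obtain ⟨s, -, h⟩ := exists_set_of_fin fun i => v (Fin.castSucc i)
    exact ⟨cup s (upair (v (Fin.last m)) (v (Fin.last m))), isSet_cup _ _,
      Fin.lastCases (by simp) fun i => by simp [h i]⟩

/-- A transitive t reflecting both φ and ∃y φ, with w and the parameters among its members, is a
collecting set. The schema reflects one formula at a time, so the two are merged into one, with
equality of two extra variables as the switch. -/
theorem collection_of_reflection (h : ReflectionPrinciple M) : CollectionPrinciple M := by
  intro n φ p w hw
  have hne : emp M ≠ upair (emp M) (emp M) := fun he =>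
    not_mem_emp (emp M) (by
      have := (mem_upair (x := emp M) (y := emp M)).2 (Or.inl rfl)
      rwa [← he] at this)
  obtain ⟨s, hs, hps⟩ := exists_set_of_fin p
  -- ∅ and {∅} provide two distinct values for the switch variables inside t.
  let x₀ := cup s (cup (upair w w) (upair (emp M) (upair (emp M) (emp M))))
  obtain ⟨t, ht, hsub, href⟩ := h _ ((caseFormula φ).relabel finSumFinEquiv) x₀ (isSet_cup _ _)
  have hp : ∀ i, Mem (p i) t := fun i => hsub _ (by simp [x₀, hps i])
  have hwt : Mem w t := hsub _ (by simp [x₀])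
  have h0 : Mem (emp M) t := hsub _ (by simp [x₀])
  have h1 : Mem (upair (emp M) (emp M)) t := hsub _ (by simp [x₀])
  have key : ∀ a : Fin 4 → Members t, (caseFormula φ).Realize
      (Sum.elim (fun i => (a i).1) p) ↔
      (caseFormula φ).Realize (Sum.elim a fun i => (⟨p i, hp i⟩ : Members t)) := by
    intro a
    let v : Fin (4 + n) → Members t :=
      Sum.elim a (fun i => (⟨p i, hp i⟩ : Members t)) ∘ finSumFinEquiv.symm
    have h2 := href (fun i => (v i).1) fun i => (v i).2
    have h3 := realizeIn_iff (φ := (caseFormula φ).relabel finSumFinEquiv) v default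
    have h4 : (fun i => ((default : Fin 0 → Members t) i).1) = (default : Fin 0 → M) :=
      Subsingleton.elim _ _
    rw [h4] at h3
    have h5 := h2.trans h3
    rw [Language.Formula.realize_relabel] at h5
    have h6 : ((caseFormula φ).relabel finSumFinEquiv).Realize v ↔ _ :=
      Language.Formula.realize_relabel
    refine (iff_of_eq ?_).trans (h5.trans (h6.trans (iff_of_eq ?_)))
    · congr 1; funext i; cases i <;> simp [v]
    · congr 1; funext i; cases i <;> simp [v]
  refine ⟨t, ht.1, fun x hx => ?_⟩
  have hxt : Mem x t := ht.mem_trans hx hwt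
  -- Unequal switch values reflect ∃y φ down to t; the last entry is a dummy.
  have k1 := key ![⟨_, h0⟩, ⟨_, h1⟩, ⟨x, hxt⟩, ⟨_, h0⟩]
  rw [realize_caseFormula, realize_caseFormula] at k1
  have hne' : (⟨_, h0⟩ : Members t) ≠ ⟨_, h1⟩ := fun he => hne (congrArg Subtype.val he)
  obtain ⟨y, hy⟩ := (k1.1 ⟨fun he => absurd he hne, fun _ => hw x hx⟩).2 hne'
  -- Equal switch values carry φ at the witness y found in t back up to the universe.
  have k2 := key ![⟨_, h0⟩, ⟨_, h0⟩, ⟨x, hxt⟩, y]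
  rw [realize_caseFormula, realize_caseFormula] at k2
  exact ⟨y.1, y.2, (k2.2 ⟨fun _ => hy, fun he => absurd rfl he⟩).1 rfl⟩

end Relativization

/-! ### Collection implies Reflection -/

section CollectionToReflection

variable {M : Type u} [lang.Structure M]

theorem realize_aut {ι : Type} (π : M ≃[lang] M) (ψ : lang.Formula (ι ⊕ Fin 1)) {v w : ι → M}
    (h : ∀ i, π (v i) = w i) (y : M) : ψ.Realize (Sum.elim w fun _ => π y) ↔
      ψ.Realize (Sum.elim v fun _ => y) := by
  rw [← Language.StrongHomClass.realize_formula π ψ (v := Sum.elim v fun _ => y)]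
  refine iff_of_eq (congrArg _ ?_)
  funext i
  rcases i with i | i
  exacts [(h i).symm, rfl]

variable [hM : Fact (ModelsZFUR M)]

/-- The urelements of `y` that are outside of `A`. -/
theorem exists_ker_diff (hwo : UrSetsWellOrderable M) (A y : M) : ∃ C, WellOrderable C ∧
    (∀ c, Mem c C → UrOff A c) ∧ (∀ c, Mem c C → Mem c (ker y)) ∧
    ∀ c, Mem c (ker y) → ¬ Mem c A → Mem c C := by
  obtain ⟨C, hC, h⟩ := Small.sep (ker y) (fun c => ¬ Mem c A)
  have hur : ∀ c, Mem c C → Ur c := fun c hc => (isSetOfUr_ker y).2 c ((h c).1 hc).1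
  exact ⟨C, hwo C ⟨hC, hur⟩, fun c hc => ⟨hur c hc, ((h c).1 hc).2⟩, fun c hc => ((h c).1 hc).1,
    fun c h1 h2 => (h c).2 ⟨h1, h2⟩⟩

/-- `A` cannot be enlarged so that fewer ordinals inject into the remaining urelements. -/
def Stable (A : M) : Prop := IsSetOfUr A ∧
  ∀ A', IsSetOfUr A' → Sub A A' → ∀ α, IsOrd α → Avail A α → Avail A' α

/-- f itself shows that α is available off A; stability then supplies the third injection, off any
enlargement of B, required for conjugacy. -/
theorem Stable.exists_aut {A B f g α : M} (hA : Stable A) (hB : IsSetOfUr B) (hAB : Sub A B)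
    (hα : IsOrd α) (hf : InjTo f α (UrOff B)) (hg : InjTo g α (UrOff B)) :
    ∃ π : M ≃[lang] M, DF (fun x => π x) ∧ (∀ ξ, Mem ξ α → π (ap f ξ) = ap g ξ) ∧
      ∀ a, Mem a B → π a = a :=
  exists_aut_conj hB hf hg fun A' hA' hBA' => hA.2 A' hA' (hAB.trans hBA') α hα
    ⟨f, hf.mono (Sub.refl _) fun u hu => ⟨hu.1, fun h => hu.2 (hAB u h)⟩⟩

/-! ### Case 1: every ordinal injects into the urelements outside A -/

section Plenty

variable {A : M}

/-- The urelements available at level `α` for the injection `f`. -/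
noncomputable def baseAt (A f α : M) : M := cup A (image (ap f) α)

instance DF.baseAt {E : Type u} [Ctx M E] (a f g : E → M) [DF a] [DF f] [DF g] :
    DF (fun e => baseAt (a e) (f e) (g e)) := by
  unfold UrelementSetTheory.baseAt; infer_instance

theorem mem_baseAt {f α u : M} : Mem u (baseAt A f α) ↔ Mem u A ∨ ∃ ξ, Mem ξ α ∧ u = ap f ξ := by
  rw [baseAt, mem_cup, mem_image]

theorem ur_of_mem_baseAt (hA : IsSetOfUr A) {f α : M} (hf : InjTo f α (UrOff A)) (u : M)
    (hu : Mem u (baseAt A f α)) : Ur u := by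
  rcases mem_baseAt.1 hu with h | ⟨ξ, hξ, rfl⟩
  exacts [hA.2 u h, (hf.1 ξ hξ).1]

theorem baseAt_mono {f α β : M} (h : Sub α β) : Sub (baseAt A f α) (baseAt A f β) := by
  intro u hu
  rcases mem_baseAt.1 hu with h' | ⟨ξ, hξ, rfl⟩
  exacts [mem_baseAt.2 (Or.inl h'), mem_baseAt.2 (Or.inr ⟨ξ, h ξ hξ, rfl⟩)]

theorem V_baseAt_mono {f α α' β : M} (hβ : IsOrd β) (hα : Mem α β) (hα' : Mem α' β) :
    Sub (V (baseAt A f α) α') (V (baseAt A f β) β) :=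
  (V_mono_left (baseAt_mono (hβ.1.2 α hα)) α').trans (hβ.V_mono _ hα')

/-- The codes are injections f. The bound on witnesses is computed for one reference injection f₀
and transferred to any other f by automorphisms fixing A. -/
theorem isHierarchy_of_plenty (hwo : UrSetsWellOrderable M) (hA : Stable A)
    (hav : ∀ α, IsOrd α → Avail A α) :
    IsHierarchy (fun f α => InjTo f α (UrOff A)) (fun f α => V (baseAt A f α) α) where
  def_ok := inferInstance
  def_level := inferInstance
  exists_code α hα := hav α hα
  ok_of_mem f α β hα hf hβ := hf.mono (hα.1.2 β hβ) fun _ h => h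
  transitive f α hα hf := isTransitiveSet_V (ur_of_mem_baseAt hA.1 hf) hα
  mono f α β hα _ hβ := V_baseAt_mono hα hβ hβ
  witness ι _ ψ α hα := by
    obtain ⟨f₀, hf₀⟩ := hav α hα
    have d1 : Def M (fun p : ((ι → M) × M) × M => ψ.Realize (Sum.elim p.1.1 fun _ => p.2)) :=
      Def.comp_pair (F := ι → M) (P := fun v y => ψ.Realize (Sum.elim v fun _ => y))
        (Def.realize_elim ψ) _ _
    have d2 : Def M (fun p : (((((ι → M) × M) × M) × M) × M) × M =>
        ψ.Realize (Sum.elim p.1.1.1.1.1 fun _ => p.2)) :=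
      Def.comp_pair (F := ι → M) (P := fun v y => ψ.Realize (Sum.elim v fun _ => y))
        (Def.realize_elim ψ) _ _
    -- For a witness y, f₀ is extended to an injection g of some γ₁ covering ker y outside A, and γ₂
    -- is a rank of y. Only the ordinals are bounded; g and y stay existentially quantified.
    obtain ⟨β, hβ, hb⟩ := exists_ord_bound_pi (V (baseAt A f₀ α) α)
      (fun (v : ι → M) γ => (∃ y, ψ.Realize (Sum.elim v fun _ => y)) →
        ∃ γ₁ g γ₂ y, (Mem γ₁ γ ∧ Mem γ₂ γ) ∧ Sub α γ₁ ∧ InjTo g γ₁ (UrOff A) ∧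
          (∀ ξ, Mem ξ α → ap g ξ = ap f₀ ξ) ∧
          Mem y (V (baseAt A g γ₁) γ₂) ∧ ψ.Realize (Sum.elim v fun _ => y)) (fun v _ => by
        by_cases hy : ∃ y, ψ.Realize (Sum.elim v fun _ => y)
        · obtain ⟨y, hy⟩ := hy
          obtain ⟨C, hC, hC1, -, hC3⟩ := exists_ker_diff hwo A y
          obtain ⟨γ₁, g, hγ₁, hs, hg, hgf, hCg, -⟩ := exists_injTo_extend hα hf₀ hC hC1
          obtain ⟨γ₂, hγ₂, hyγ⟩ := exists_mem_V_ker y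
          obtain ⟨γ, hγ, h1, h2⟩ := exists_ord_mem₂ hγ₁ hγ₂
          refine ⟨γ, hγ, fun _ => ⟨γ₁, g, γ₂, y, ⟨h1, h2⟩, hs, hg, hgf,
            V_mono_left (fun u hu => mem_baseAt.2 ?_) γ₂ y hyγ, hy⟩⟩
          by_cases huA : Mem u A
          exacts [Or.inl huA, Or.inr (hCg u (hC3 u hu huA))]
        · exact ⟨α, hα, fun h => absurd h hy⟩)
    refine ⟨β, hβ, fun f hfα hfβ v hv hy => ?_⟩
    obtain ⟨y, hy⟩ := hy
    -- π carries f to f₀ on α, so the bound applies to the moved tuple and gives z over g; below, π'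
    -- carries g back to f on γ₁.
    obtain ⟨π, dπ, hπf, hπA⟩ := hA.exists_aut hA.1 (Sub.refl _) hα hfα hf₀
    obtain ⟨γ, hγ, h⟩ := hb (fun i => π (v i)) fun i => aut_mem_V π (fun u hu => by
      rcases mem_baseAt.1 hu with h | ⟨ξ, hξ, rfl⟩
      · rw [hπA u h]; exact mem_baseAt.2 (Or.inl h)
      · rw [hπf ξ hξ]; exact mem_baseAt.2 (Or.inr ⟨ξ, hξ, rfl⟩)) (hv i)
    obtain ⟨γ₁, g, γ₂, z, ⟨h1, h2⟩, hs, hg, hgf, hz, hψz⟩ :=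
      h ⟨π y, (realize_aut π ψ (fun _ => rfl) y).2 hy⟩
    have hγ₁β := hβ.mem_trans h1 hγ
    obtain ⟨π', dπ', hπ'g, hπ'A⟩ := hA.exists_aut hA.1 (Sub.refl _) (hβ.mem hγ₁β) hg
      (hfβ.mono (hβ.1.2 _ hγ₁β) fun _ h => h)
    have dcomp := DF.aut_comp π π'
    -- As g extends f₀, the composite sends f ξ to f₀ ξ = g ξ and back to f ξ for ξ ∈ α. Thus it
    -- fixes the base at level α, hence the original parameters.
    have hfix : ∀ i, π' (π (v i)) = v i := fun i =>
      aut_eq_self_of_mem_V (π'.comp π) (ur_of_mem_baseAt hA.1 hfα) hα (fun u hu => by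
        rw [Language.Equiv.comp_apply]
        rcases mem_baseAt.1 hu with h | ⟨ξ, hξ, rfl⟩
        · rw [hπA u h, hπ'A u h]
        · rw [hπf ξ hξ, ← hgf ξ hξ, hπ'g ξ (hs ξ hξ)]) (hv i)
    refine ⟨π' z, V_baseAt_mono hβ hγ₁β (hβ.mem_trans h2 hγ) _ (aut_mem_V π' (fun u hu => ?_) hz),
      (realize_aut π' ψ hfix z).2 hψz⟩
    rcases mem_baseAt.1 hu with h | ⟨ξ, hξ, rfl⟩
    · rw [hπ'A u h]; exact mem_baseAt.2 (Or.inl h)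
    · rw [hπ'g ξ hξ]; exact mem_baseAt.2 (Or.inr ⟨ξ, hξ, rfl⟩)

end Plenty

/-! ### Case 2: some ordinal does not inject into the urelements outside A -/

section Scarcity

variable {A θ : M}

/-- Every ordinal below `θ` injects into the class `P`. -/
def Universal (θ : M) (P : M → Prop) : Prop := ∀ α, Mem α θ → ∃ f, InjTo f α P

theorem Universal.image {P Q : M → Prop} (h : Universal θ P) (j : M → M) [DF j]
    (hj : ∀ u, P u → Q (j u)) (hinj : ∀ u w, P u → P w → j u = j w → u = w) :
    Universal θ Q := by
  intro α hα
  obtain ⟨f, hf⟩ := h α hα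
  have d : DF (fun ξ => j (ap f ξ)) := DF.fun_comp ‹DF j› inferInstance
  exact ⟨_, injTo_graph (fun ξ => j (ap f ξ)) (fun ξ hξ => hj _ (hf.1 ξ hξ)) fun ξ η hξ hη he =>
    hf.2 ξ η hξ hη (hinj _ _ (hf.1 ξ hξ) (hf.1 η hη) he)⟩

/-- Collection yields a set of urelements outside of `B` that is as large as the class of these. -/
theorem exists_universal (hcol : CollectionPrinciple M) (hθ : IsOrd θ) {B : M}
    (h : ∀ α, Mem α θ → Avail B α) :
    ∃ D, IsSet D ∧ (∀ u, Mem u D → UrOff B u) ∧ Universal θ (fun u => Mem u D) := by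
  -- Collection gathers injections for all α below θ; D is the union of the ranges of those members
  -- of v that are such injections.
  obtain ⟨v, -, hv⟩ := hcol.collect (R := fun α f => InjTo f α (UrOff B)) inferInstance θ h
  have d : DF (fun f : M => image (ap f) θ) := inferInstance
  obtain ⟨w, -, hw⟩ := Small.iUnion (fun f => image (ap f) θ) v
  obtain ⟨D, hD, hD'⟩ : Small (fun u => ∃ f, Mem f v ∧ ∃ α, Mem α θ ∧ InjTo f α (UrOff B) ∧
      ∃ ξ, Mem ξ α ∧ u = ap f ξ) := Small.of_subset (w := w) (by
    rintro u ⟨f, hf, α, hα, -, ξ, hξ, rfl⟩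
    exact (hw _).2 ⟨f, hf, mem_image.2 ⟨ξ, hθ.mem_trans hξ hα, rfl⟩⟩)
  refine ⟨D, hD, fun u hu => ?_, fun α hα => ?_⟩
  · obtain ⟨f, -, α, -, h1, ξ, hξ, rfl⟩ := (hD' u).1 hu
    exact h1.1 ξ hξ
  · obtain ⟨f, hf, h1⟩ := hv α hα
    exact ⟨f, fun ξ hξ => (hD' _).2 ⟨f, hf, α, hα, h1, ξ, hξ, rfl⟩, h1.2⟩

/-- `θ` is the least ordinal that does not inject into the urelements outside of `A`. -/
def IsLeastUnavail (A θ : M) : Prop := IsOrd θ ∧ ∀ α, IsOrd α → (Avail A α ↔ Mem α θ)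

theorem exists_isLeastUnavail (h : ¬ ∀ α, IsOrd α → Avail A α) : ∃ θ, IsLeastUnavail A θ := by
  push Not at h
  obtain ⟨θ, hθ, hn, hmin⟩ := exists_least (fun α => ¬ Avail A α) h
  refine ⟨θ, hθ, fun α hα => ⟨fun hav => ?_, fun hα => not_not.1 (hmin α hα)⟩⟩
  by_contra hne
  obtain ⟨f, hf⟩ := hav
  exact hn ⟨f, hf.mono (hα.sub_of_not_mem hθ hne) fun _ h => h⟩

/-- A large set of urelements with two injections into itself that have disjoint ranges. -/
theorem exists_absorbing (hwo : UrSetsWellOrderable M) (hcol : CollectionPrinciple M)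
    (hA : Stable A) (hθ : IsLeastUnavail A θ) :
    ∃ (D : M) (j₀ j₁ : M → M), DF j₀ ∧ DF j₁ ∧ (∀ u, Mem u D → UrOff A u) ∧
      Universal θ (fun u => Mem u D) ∧ (∀ u, Mem u D → Mem (j₀ u) D ∧ Mem (j₁ u) D) ∧
      (∀ u w, Mem u D → Mem w D → j₀ u ≠ j₁ w) ∧
      (∀ u w, Mem u D → Mem w D → j₀ u = j₀ w → u = w) ∧
      ∀ u w, Mem u D → Mem w D → j₁ u = j₁ w → u = w := by
  obtain ⟨D₀, hD₀s, hD₀, hD₀u⟩ := exists_universal hcol hθ.1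
    fun α hα => (hθ.2 α (hθ.1.mem hα)).2 hα
  have hB : IsSetOfUr (cup A D₀) := ⟨isSet_cup _ _, fun u hu => by
    rcases mem_cup.1 hu with h | h
    exacts [hA.1.2 u h, (hD₀ u h).1]⟩
  have hAB : Sub A (cup A D₀) := fun u hu => mem_cup.2 (Or.inl hu)
  -- Stability leaves all ordinals below θ available after D₀ is removed, so a second universal set
  -- can be chosen disjoint from D₀.
  obtain ⟨D₁, hD₁s, hD₁, hD₁u⟩ := exists_universal hcol hθ.1
    fun α hα => hA.2 _ hB hAB α (hθ.1.mem hα) ((hθ.2 α (hθ.1.mem hα)).2 hα)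
  have hDoff : ∀ u, Mem u (cup D₀ D₁) → UrOff A u := fun u hu => by
    rcases mem_cup.1 hu with h | h
    exacts [hD₀ u h, ⟨(hD₁ u h).1, fun h' => (hD₁ u h).2 (hAB u h')⟩]
  obtain ⟨δ, g, hδ, -, hg, -, honto, -⟩ := exists_injTo_extend (f := emp M) (P := UrOff A) isOrd_emp
    ⟨fun ξ hξ => absurd hξ (not_mem_emp ξ), fun ξ _ hξ => absurd hξ (not_mem_emp ξ)⟩
    (hwo (cup D₀ D₁) ⟨isSet_cup _ _, fun u hu => (hDoff u hu).1⟩) hDoff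
  -- D₀ ∪ D₁ is enumerated by an ordinal δ that injects off A, so δ is below θ and injects into each
  -- half. The maps j₀ and j₁ pass through this enumeration.
  have hδθ := (hθ.2 δ hδ).1 ⟨g, hg⟩
  obtain ⟨f₀, hf₀⟩ := hD₀u δ hδθ
  obtain ⟨f₁, hf₁⟩ := hD₁u δ hδθ
  let k : M → M := fun u => the (fun ξ => Mem ξ δ ∧ u = ap g ξ)
  have dk : DF k := by dsimp only [k]; infer_instance
  have hk : ∀ u, Mem u (cup D₀ D₁) → Mem (k u) δ ∧ u = ap g (k u) := by
    intro u hu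
    obtain ⟨ξ, hξ, h⟩ := honto u hu
    exact the_spec (P := fun ξ => Mem ξ δ ∧ u = ap g ξ)
      ⟨ξ, ⟨hξ, h⟩, fun η hη => hg.2 η ξ hη.1 hξ (hη.2.symm.trans h)⟩
  have kinj : ∀ u w, Mem u (cup D₀ D₁) → Mem w (cup D₀ D₁) → k u = k w → u = w :=
    fun u w hu hw h => by rw [(hk u hu).2, (hk w hw).2, h]
  have e0 : ∀ u, Mem u (cup D₀ D₁) → Mem (ap f₀ (k u)) D₀ := fun u hu => hf₀.1 _ (hk u hu).1
  have e1 : ∀ u, Mem u (cup D₀ D₁) → Mem (ap f₁ (k u)) D₁ := fun u hu => hf₁.1 _ (hk u hu).1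
  refine ⟨cup D₀ D₁, fun u => ap f₀ (k u), fun u => ap f₁ (k u), inferInstance, inferInstance,
    hDoff, hD₀u.image (fun u => u) (fun u hu => mem_cup.2 (Or.inl hu)) (fun _ _ _ _ h => h),
    fun u hu => ⟨mem_cup.2 (Or.inl (e0 u hu)), mem_cup.2 (Or.inr (e1 u hu))⟩,
    fun u w hu hw h => ?_,
    fun u w hu hw h => kinj u w hu hw (hf₀.2 _ _ (hk u hu).1 (hk w hw).1 h),
    fun u w hu hw h => kinj u w hu hw (hf₁.2 _ _ (hk u hu).1 (hk w hw).1 h)⟩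
  exact (hD₁ _ (e1 w hw)).2 (mem_cup.2 (Or.inr
    ((show ap f₀ (k u) = ap f₁ (k w) from h) ▸ e0 u hu)))

/-- An increasing sequence of sets of urelements, each much larger than the one before. -/
theorem exists_chain (hwo : UrSetsWellOrderable M) (hcol : CollectionPrinciple M)
    (hA : Stable A) (hθ : IsLeastUnavail A θ) :
    ∃ X : M → M, DF X ∧ (∀ n, Mem n (omega M) → ∀ u, Mem u (X n) → UrOff A u) ∧
      (∀ n m, Mem n (omega M) → Mem m n → Sub (X m) (X n)) ∧
      ∀ n, Mem n (omega M) → Universal θ (fun u => Mem u (X (succ n)) ∧ ¬ Mem u (X n)) := by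
  obtain ⟨D, j₀, j₁, d₀, d₁, hDoff, hDu, hjD, hj, hj₀, hj₁⟩ := exists_absorbing hwo hcol hA hθ
  have dH : DF (fun Y : M => cup (image j₁ D) (image j₀ Y)) := by
    have h1 : DF (fun p : M × M => j₀ p.2) := d₀.comp _
    infer_instance
  -- X_0 is empty, X_1 = j₁[D], and each new layer X_{n+1} \ X_n is carried by j₀ into the next one;
  -- disjointness of the ranges of j₀ and j₁ keeps the layers apart.
  obtain ⟨X, dX, hX⟩ := exists_iterate (fun Y : M => cup (image j₁ D) (image j₀ Y)) (emp M)
  have hmem : ∀ n, Mem n (omega M) → ∀ u, Mem u (X n) ↔ ∃ m, Mem m n ∧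
      ((∃ e, Mem e D ∧ u = j₁ e) ∨ ∃ w, Mem w (X m) ∧ u = j₀ w) := by
    intro n hn u
    rw [(hX n hn).2 u]
    simp only [not_mem_emp, false_or, mem_cup, mem_image]
  have hXD : ∀ n, Mem n (omega M) → Sub (X n) D := by
    refine mem_induction _ fun n ih hn u hu => ?_
    obtain ⟨m, hm, ⟨e, he, rfl⟩ | ⟨w, hw, rfl⟩⟩ := (hmem n hn u).1 hu
    exacts [(hjD e he).2, (hjD w (ih m hm (isTransitiveSet_omega.mem_trans hm hn) w hw)).1]
  have hmono : ∀ n m, Mem n (omega M) → Mem m n → Sub (X m) (X n) := by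
    intro n m hn hm u hu
    obtain ⟨l, hl, h⟩ := (hmem m (isTransitiveSet_omega.mem_trans hm hn) u).1 hu
    exact (hmem n hn u).2 ⟨l, (isTransitiveSet_of_mem_omega hn).mem_trans hl hm, h⟩
  refine ⟨X, dX, fun n hn u hu => hDoff u (hXD n hn u hu), hmono, ?_⟩
  have hdef : Def M (fun n : M => Universal θ (fun u => Mem u (X (succ n)) ∧ ¬ Mem u (X n))) := by
    have : DF (fun p : ((M × M) × M) × M => X (succ p.1.1.1)) := DF.fun_comp dX inferInstance
    have h2 : Def M (fun p : (M × M) × M =>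
        InjTo p.2 p.1.2 (fun u => Mem u (X (succ p.1.1)) ∧ ¬ Mem u (X p.1.1))) :=
      Def.injTo _ _ (fun p : (M × M) × M => fun u => Mem u (X (succ p.1.1)) ∧ ¬ Mem u (X p.1.1))
    unfold Universal
    infer_instance
  intro n hn
  refine omega_induction
    (fun n => Universal θ (fun u => Mem u (X (succ n)) ∧ ¬ Mem u (X n))) ?_ ?_ hn
  · refine hDu.image j₁ (fun u hu => ⟨?_, fun h => ?_⟩) hj₁
    · exact (hmem _ (succ_mem_omega emp_mem_omega) _).2 ⟨_, mem_succ_self _, Or.inl ⟨u, hu, rfl⟩⟩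
    · obtain ⟨m, hm, -⟩ := (hmem _ emp_mem_omega _).1 h
      exact not_mem_emp m hm
  · intro n hn ih
    have hn1 := succ_mem_omega hn
    refine ih.image j₀ (fun u hu => ⟨?_, fun h => ?_⟩)
      (fun u w hu hw => hj₀ u w (hXD _ hn1 u hu.1) (hXD _ hn1 w hw.1))
    · exact (hmem _ (succ_mem_omega hn1) _).2 ⟨_, mem_succ_self _, Or.inr ⟨u, hu.1, rfl⟩⟩
    · obtain ⟨m, hm, ⟨e, he, h⟩ | ⟨w, hw, h⟩⟩ := (hmem _ hn1 _).1 h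
      · exact hj u e (hXD _ hn1 u hu.1) he h
      · have hwn : Mem w (X n) := by
          rcases mem_succ.1 hm with hm | rfl
          exacts [hmono n m hn hm w hw, hw]
        rw [hj₀ u w (hXD _ hn1 u hu.1) (hXD n hn w hwn) h] at hu
        exact hu.2 hwn

/-- With B n = A ∪ X_n, level α is the union over n of V(B n, α). Elementarity is Tarski–Vaught: a
witness is moved so that its urelements lie in B(n+1), while the parameters over B n stay fixed. -/
theorem exists_hierarchy_of_scarcity (hwo : UrSetsWellOrderable M) (hcol : CollectionPrinciple M)
    (hA : Stable A) (hθ : IsLeastUnavail A θ) :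
    ∃ S : M → M, IsHierarchy (fun _ _ : M => True) (fun _ α => S α) ∧
      ∀ α, IsOrd α → IsTransitiveSet (S α) ∧ Sub (V A α) (S α) := by
  obtain ⟨X, dX, hXoff, hXmono, hXu⟩ := exists_chain hwo hcol hA hθ
  let B : M → M := fun n => cup A (X n)
  have dB : DF B := inferInstanceAs (DF (fun n => cup A (X n)))
  have hB : ∀ n, Mem n (omega M) → IsSetOfUr (B n) := fun n hn => ⟨isSet_cup _ _, fun u hu => by
    rcases mem_cup.1 hu with h | h
    exacts [hA.1.2 u h, (hXoff n hn u h).1]⟩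
  have hAB : ∀ n, Sub A (B n) := fun n u hu => mem_cup.2 (Or.inl hu)
  have hBmono : ∀ n m, Mem n (omega M) → Mem m n → Sub (B m) (B n) := fun n m hn hm u hu => by
    rcases mem_cup.1 hu with h | h
    exacts [hAB n u h, mem_cup.2 (Or.inr (hXmono n m hn hm u h))]
  let S : M → M := fun α => mkSet (fun z => ∃ n, Mem n (omega M) ∧ Mem z (V (B n) α))
  have dS : DF S := by dsimp only [S]; infer_instance
  have hS : ∀ α z, Mem z (S α) ↔ ∃ n, Mem n (omega M) ∧ Mem z (V (B n) α) := fun α z =>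
    (Small.iUnion (fun n => V (B n) α) (omega M)).mem_mk
  have hT : ∀ α, IsOrd α → IsTransitiveSet (S α) := fun α hα => ⟨isSet_mk _, fun y hy z hz => by
    obtain ⟨n, hn, hy⟩ := (hS α y).1 hy
    exact (hS α z).2 ⟨n, hn, (isTransitiveSet_V (hB n hn).2 hα).mem_trans hz hy⟩⟩
  refine ⟨S, isHierarchy_of_elementary S hT (fun α β hα hβ z hz => ?_) ?_, fun α hα => ⟨hT α hα,
    fun z hz => (hS α z).2 ⟨_, emp_mem_omega, V_mono_left (hAB _) α z hz⟩⟩⟩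
  · obtain ⟨n, hn, hz⟩ := (hS β z).1 hz
    exact (hS α z).2 ⟨n, hn, hα.V_mono _ hβ z hz⟩
  · intro ι _ ψ α hα v hv ⟨y, hy⟩
    obtain ⟨n, hn, hvn⟩ : ∃ n, Mem n (omega M) ∧ ∀ i, Mem (v i) (V (B n) α) := by
      classical
      have := Fintype.ofFinite ι
      suffices ∀ s : Finset ι, ∃ n, Mem n (omega M) ∧ ∀ i ∈ s, Mem (v i) (V (B n) α) by
        obtain ⟨n, hn, h⟩ := this Finset.univ
        exact ⟨n, hn, fun i => h i (Finset.mem_univ i)⟩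
      intro s
      induction s using Finset.induction_on with
      | empty => exact ⟨_, emp_mem_omega, fun i hi => absurd hi (Finset.notMem_empty i)⟩
      | insert i s _ ih =>
        obtain ⟨n, hn, h⟩ := ih
        obtain ⟨m, hm, hi⟩ := (hS α (v i)).1 (hv i)
        simp only [Finset.forall_mem_insert]
        rcases (isOrd_of_mem_omega hn).trichotomy (isOrd_of_mem_omega hm) with hlt | rfl | hlt
        · exact ⟨m, hm, hi, fun k hk => V_mono_left (hBmono m n hm hlt) α _ (h k hk)⟩
        · exact ⟨n, hn, hi, h⟩
        · exact ⟨n, hn, V_mono_left (hBmono n m hn hlt) α _ hi, h⟩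
    obtain ⟨C, hC, hC1, -, hC3⟩ := exists_ker_diff hwo (B n) y
    obtain ⟨β, g, hβ, -, hg, -, hCg, hgC⟩ := exists_injTo_extend (f := emp M) (P := UrOff (B n))
      isOrd_emp ⟨fun ξ hξ => absurd hξ (not_mem_emp ξ), fun ξ _ hξ => absurd hξ (not_mem_emp ξ)⟩
      hC hC1
    -- β enumerates the kernel of y outside B n, hence injects off A and lies below θ; so it also
    -- injects into X_{n+1} \ X_n, the target of π.
    have hβθ : Mem β θ := (hθ.2 β hβ).1 ⟨g, hg.mono (Sub.refl _) fun u hu =>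
      ⟨hu.1, fun h => hu.2 (hAB n u h)⟩⟩
    obtain ⟨f, hf⟩ := hXu n hn β hβθ
    have hn1 := succ_mem_omega hn
    obtain ⟨π, dπ, hπg, hπB⟩ := hA.exists_aut (hB n hn) (hAB n) hβ hg
      (hf.mono (Sub.refl _) fun u hu => ⟨(hXoff _ hn1 u hu.1).1, fun h => by
        rcases mem_cup.1 h with h | h
        exacts [(hXoff _ hn1 u hu.1).2 h, hu.2 h]⟩)
    have hfix : ∀ i, π (v i) = v i := fun i =>
      aut_eq_self_of_mem_V π (hB n hn).2 hα hπB (hvn i)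
    obtain ⟨γ, hγ, hyγ⟩ := exists_mem_V_ker y
    refine ⟨γ, hγ, π y, (hS γ _).2 ⟨succ n, hn1, aut_mem_V π (fun u hu => ?_) hyγ⟩,
      (realize_aut π ψ hfix y).2 hy⟩
    by_cases hun : Mem u (B n)
    · rw [hπB u hun]
      exact hBmono _ n hn1 (mem_succ_self n) u hun
    · obtain ⟨ξ, hξ, rfl⟩ := hCg u (hC3 u hu hun)
      rw [hπg ξ hξ]
      exact mem_cup.2 (Or.inr (hf.1 ξ hξ).1)

end Scarcity

theorem reflection_of_collection (hwo : UrSetsWellOrderable M) (hcol : CollectionPrinciple M) :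
    ReflectionPrinciple M := by
  intro n φ x _
  -- Starting from ker x ensures that x lies in V(A, α), hence is included in level α of either
  -- hierarchy.
  obtain ⟨A, hA, hsub, hst⟩ := exists_avail_stable (isSetOfUr_ker x)
  obtain ⟨α, hα, hxα⟩ := exists_mem_V_ker x
  by_cases hav : ∀ α, IsOrd α → Avail A α
  · refine (isHierarchy_of_plenty hwo ⟨hA, hst⟩ hav).exists_reflecting hα (fun f hf => ?_) φ
    refine (isTransitiveSet_V (ur_of_mem_baseAt hA hf) hα).2 x (V_mono_left ?_ α x hxα)
    exact fun u hu => mem_baseAt.2 (Or.inl (hsub u hu))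
  · obtain ⟨θ, hθ⟩ := exists_isLeastUnavail hav
    obtain ⟨S, hS, hS'⟩ := exists_hierarchy_of_scarcity hwo hcol ⟨hA, hst⟩ hθ
    exact hS.exists_reflecting hα
      (fun _ _ => (hS' α hα).1.2 x ((hS' α hα).2 x (V_mono_left hsub α x hxα))) φ

end CollectionToReflection

end UrelementSetTheory

theorem mainTheorem10 (M : Type u) [UrelementSetTheory.lang.Structure M]
    (hM : UrelementSetTheory.ModelsZFUR M) :
    (UrelementSetTheory.UrSetsWellOrderable M →
      (UrelementSetTheory.CollectionPrinciple M ↔ UrelementSetTheory.ReflectionPrinciple M)) ∧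
    (UrelementSetTheory.UrelementsFormSet M → UrelementSetTheory.ReflectionPrinciple M) := by
  have : Fact (UrelementSetTheory.ModelsZFUR M) := ⟨hM⟩
  exact ⟨fun hwo => ⟨UrelementSetTheory.reflection_of_collection hwo,
    UrelementSetTheory.collection_of_reflection⟩,
    UrelementSetTheory.reflection_of_urelementsFormSet⟩
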